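/- Let $G$ be a finite undirected loopless graph (multiple edges allowed) with nonnegative real edge weights $\mathbf w=\{w_e\}_{e\in E(G)}$. For distinct vertices $x,y$ let $\lambda(x,y)$ be the maximum flow from $x$ to $y$ with edge capacities $\mathbf w$, i.e. the minimum of $\sum_{e\in E(S,V(G)\setminus S)}w_e$ over $S\subseteq V(G)$ with $x\in S$, $y\notin S$, and let $\Lambda=\max_{x\ne y}\lambda(x,y)$ be the maxmaxflow ($\Lambda=0$ if there are no two distinct vertices). For a graph $H$, a cut vertex is a vertex whose deletion increases the number of components; the other vertices are internal. $H$ is non-separable if it is (nonempty and) connected and has no cut vertex, and a block of $H$ is a maximal non-separable subgraph. A block of $H$ is isolated if it contains no cut vertex of $H$, and an end block if it contains exactly one. For $X,Y\subseteq V(G)$ with $Y\neq\emptyset$ and $m\ge 0$ let $\mathcal{BF}^*_m(X,Y)$ be the set of $m$-edge subgraphs $H$ of $G$ (connected or not) such that 1. $X\cup Y\subseteq V(H)$; 2. each component of $H$ contains at least one vertex of $Y$; 3. each end block of $H$ contains a vertex of $X\cup Y$ that is an internal vertex of $H$; 4. each isolated block of $H$ is either an isolated vertex belonging to $Y$ or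 contains at least two vertices of $X\cup Y$. Let $\mathcal{BF}_m(X,Y)$ be defined in the same way with "exactly one" in place of "at least one" in (2). For nonempty $X\subseteq V(G)$ let $\mathcal{BT}_m(X)$ be the set of connected $m$-edge subgraphs $H$ of $G$ with $X\subseteq V(H)$ such that each end block of $H$ contains a vertex of $X$ that is an internal vertex of $H$, and such that, if $H$ is a block, then $H$ is an isolated vertex or contains at least two vertices of $X$. Put $w(H)=\prod_{e\in E(H)}w_e$, and let $bf^*_m(X,Y)$, $bf_m(X,Y)$, $bt_m(X)$ be the sums of $w(H)$ over $\mathcal{BF}^*_m(X,Y)$, $\mathcal{BF}_m(X,Y)$, $\mathcal{BT}_m(X)$ respectively. **Proposition.** For all $X,Y\subseteq V(G)$ with $Y\ne\emptyset$ and all $\alpha\in(1,2]$, $$\sum_{m=0}^\infty\Bigl(\frac{\alpha\Lambda}{\ln\alpha}\Bigr)^{-m}bf^*_m(X,Y)\le\alpha^{|Y|-1}.$$ Consequently also $$\sum_{m=0}^\infty\Bigl(\frac{\alpha\Lambda}{\ln\alpha}\Bigr)^{-m}bf_m(X,Y)\le\alpha^{|Y|-1},$$ and, for all nonempty $X\subseteq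 V(G)$, $$\sum_{m=0}^\infty\Bigl(\frac{2\Lambda}{\ln 2}\Bigr)^{-m}bt_m(X)\le 1.$$ If $\Lambda=0$, then $bf^*_m(X,Y)=bf_m(X,Y)=bt_m(X)=0$ for all $m\ge1$, and the terms with $m\ge 1$ are read as $0$. -/

import Mathlib

/-!
Graphs are Mathlib's multigraphs `Graph ν ε` (parallel edges allowed); subgraphs of `G` are the
terms `H : Graph ν ε` with `H ≤ G`. The main statement is about graphs with finitely many vertices
and edges and without loops, so all the cardinalities, sums and products below are finite.
-/

open scoped Graph

noncomputable section

namespace Graph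

variable {ν ε : Type*}

/-! ### Components, cut vertices and blocks -/

/-- The vertex set of the connected component of `H` that contains the vertex `x`. -/
def component (H : Graph ν ε) (x : ν) : Set ν := {y | Relation.ReflTransGen H.Adj x y}

/-- The (vertex sets of the) connected components of `H`. -/
def components (H : Graph ν ε) : Set (Set ν) := H.component '' V(H)

/-- `H` is connected: it has a vertex, and any two of its vertices are joined by a walk. -/
def IsConnected (H : Graph ν ε) : Prop :=
  V(H).Nonempty ∧ ∀ x ∈ V(H), ∀ y ∈ V(H), y ∈ H.component x

/-- `x` is a cut vertex of `H`: a vertex whose deletion increases the number of components. -/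
def IsCutVertex (H : Graph ν ε) (x : ν) : Prop :=
  x ∈ V(H) ∧ H.components.ncard < (H.deleteVerts {x}).components.ncard

/-- `H` is non-separable: connected and without cut vertices. -/
def IsNonSeparable (H : Graph ν ε) : Prop :=
  H.IsConnected ∧ ∀ x, ¬ H.IsCutVertex x

/-- `B` is a block of `H`: a maximal non-separable subgraph of `H`. -/
def IsBlock (B H : Graph ν ε) : Prop :=
  Maximal (fun K : Graph ν ε => K ≤ H ∧ K.IsNonSeparable) B

/-- `B` is an isolated block of `H`: a block of `H` containing no cut vertex of `H`. -/
def IsIsolatedBlock (B H : Graph ν ε) : Prop :=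
  B.IsBlock H ∧ ∀ x ∈ V(B), ¬ H.IsCutVertex x

/-- `B` is an end block of `H`: a block of `H` containing exactly one cut vertex of `H`. -/
def IsEndBlock (B H : Graph ν ε) : Prop :=
  B.IsBlock H ∧ ∃! x, x ∈ V(B) ∧ H.IsCutVertex x

/-- `Int(B, H)`: the vertices of `B` that are internal vertices (not cut vertices) of `H`. -/
def internalVerts (B H : Graph ν ε) : Set ν := {x | x ∈ V(B) ∧ ¬ H.IsCutVertex x}

/-! ### Block trees and block forests -/

/-- The set `BT_m(X)` of `m`-edge block trees in `G`. -/
def blockTrees (G : Graph ν ε) (m : ℕ) (X : Set ν) : Set (Graph ν ε) :=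
  {H | H ≤ G ∧ E(H).ncard = m ∧
    X ⊆ V(H) ∧
    H.IsConnected ∧
    (∀ B : Graph ν ε, B.IsEndBlock H → (B.internalVerts H ∩ X).Nonempty) ∧
    (H.IsBlock H → (∃ x, H = Graph.noEdge {x} ε) ∨ (V(H) ∩ X).Nontrivial)}

/-- The set `BF_m(X, Y)` of `m`-edge block forests in `G`:
each component contains exactly one vertex of `Y`. -/
def blockForests (G : Graph ν ε) (m : ℕ) (X Y : Set ν) : Set (Graph ν ε) :=
  {H | H ≤ G ∧ E(H).ncard = m ∧
    X ∪ Y ⊆ V(H) ∧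
    (∀ C ∈ H.components, ∃! y, y ∈ C ∧ y ∈ Y) ∧
    (∀ B : Graph ν ε, B.IsEndBlock H → (B.internalVerts H ∩ (X ∪ Y)).Nonempty) ∧
    (∀ B : Graph ν ε, B.IsIsolatedBlock H →
      (∃ y ∈ Y, B = Graph.noEdge {y} ε) ∨ (V(B) ∩ (X ∪ Y)).Nontrivial)}

/-- The set `BF*_m(X, Y)` of `m`-edge enlarged block forests in `G`:
each component contains at least one vertex of `Y`. -/
def enlargedBlockForests (G : Graph ν ε) (m : ℕ) (X Y : Set ν) : Set (Graph ν ε) :=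
  {H | H ≤ G ∧ E(H).ncard = m ∧
    X ∪ Y ⊆ V(H) ∧
    (∀ C ∈ H.components, ∃ y, y ∈ C ∧ y ∈ Y) ∧
    (∀ B : Graph ν ε, B.IsEndBlock H → (B.internalVerts H ∩ (X ∪ Y)).Nonempty) ∧
    (∀ B : Graph ν ε, B.IsIsolatedBlock H →
      (∃ y ∈ Y, B = Graph.noEdge {y} ε) ∨ (V(B) ∩ (X ∪ Y)).Nontrivial)}

/-! ### Weighted counts -/

/-- The weight `w(H) = ∏_{e ∈ E(H)} w_e` of a graph `H`. -/
def weight (H : Graph ν ε) (w : ε → ℝ) : ℝ := ∏ᶠ e ∈ E(H), w e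

/-- `bt_m(X)`, the total weight of the block trees in `BT_m(X)`. -/
def bt (G : Graph ν ε) (w : ε → ℝ) (m : ℕ) (X : Set ν) : ℝ :=
  ∑ᶠ H ∈ G.blockTrees m X, H.weight w

/-- `bf_m(X, Y)`, the total weight of the block forests in `BF_m(X, Y)`. -/
def bf (G : Graph ν ε) (w : ε → ℝ) (m : ℕ) (X Y : Set ν) : ℝ :=
  ∑ᶠ H ∈ G.blockForests m X Y, H.weight w

/-- `bf*_m(X, Y)`, the total weight of the enlarged block forests in `BF*_m(X, Y)`. -/
def bfStar (G : Graph ν ε) (w : ε → ℝ) (m : ℕ) (X Y : Set ν) : ℝ :=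
  ∑ᶠ H ∈ G.enlargedBlockForests m X Y, H.weight w

/-! ### Maxmaxflow -/

/-- The edges of `G` with one end in `S` and the other end outside `S`. -/
def cutEdges (G : Graph ν ε) (S : Set ν) : Set ε :=
  {e | ∃ x y, G.IsLink e x y ∧ x ∈ S ∧ y ∉ S}

/-- `λ_G(x, y; w)`: the maximum flow from `x` to `y` with edge capacities `w`, given as the minimum
of the weights of the cuts of `G` that separate `x` from `y`. For distinct vertices `x, y` of a
finite graph this is an infimum over a finite non-empty set of numbers, hence a minimum. -/
def minCut (G : Graph ν ε) (w : ε → ℝ) (x y : ν) : ℝ :=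
  sInf {c | ∃ S ⊆ V(G), x ∈ S ∧ y ∉ S ∧ c = ∑ᶠ e ∈ G.cutEdges S, w e}

/-- The maxmaxflow `Λ(G, w)`: the maximum of `λ_G(x, y; w)` over pairs of distinct vertices;
it is `0` if there is no such pair. -/
def maxmaxflow (G : Graph ν ε) (w : ε → ℝ) : ℝ :=
  sSup {c | ∃ x ∈ V(G), ∃ y ∈ V(G), x ≠ y ∧ c = G.minCut w x y}

end Graph

end

/-! The graphs counted are replaced by their edge sets `A`, of which only `IsRooted` is kept: every
vertex is joined to `Y`, and after deletion of any vertex `c` the remaining ends of edges of `A` are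
still joined to `X ∪ Y`. With `t = w * log α / (α * Λ)` for `Λ > 0`, any two vertices are separated
by a cut of `t`-weight at most `log α / α`, and the claim becomes `∑ ∏ t ≤ α ^ (|Y| - 1)` over
rooted sets (`sum_isRooted_le`).

This is proved by induction on the vertex set. A cut `S` separating two points of `X ∪ Y` splits `A`
into cut edges `F` and a part on each side. Each part is rooted once the ends of `F` are added to
its roots (`IsRooted.restrict`). Since `F` may create `2|F|` new roots, a bound in terms of `|Y|`
alone would lose a factor `α ^ (2|F|)`, while only `α ^ |F|` is affordable: `∑_F ∏ t * α ^ |F| ≤ exp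
(α ∑ t) ≤ α` (`sum_powerset_prod_mul_pow_le`). The loss is recovered by strengthening the induction.
Each `A` carries the factor `α ^ (-b)`, where `b` counts the classes of roots left after merging
along `A` on top of a given relation `s`. New roots start as separate classes, but rootedness forces
`A` to attach them to old ones (`rootedSum_le`). At the end `s` identifies all of `Y`, and the extra
factor is constant.

That block forests and block trees are rooted is a fact about blocks. If a component of `H - c`
avoids `X ∪ Y`, a minimal such component together with its deleted vertex spans an end block or
isolated block that violates the definition (`exists_isBlock_of_component_disjoint`). -/

section ClassCount

/-! ### Counting the classes of an equivalence relation that meet a finite set -/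

open Classical in
/-- The number of classes of the equivalence relation `s` that meet the finite set `W`. -/
noncomputable def Setoid.classCount {ν : Type*} (s : Setoid ν) (W : Finset ν) : ℕ :=
  (W.image (Quotient.mk s)).card

namespace Setoid

variable {ν : Type*} {s t : Setoid ν} {W W' : Finset ν}

lemma classCount_le_of_forall_exists (h : ∀ w ∈ W', ∃ v ∈ W, s w v) :
    s.classCount W' ≤ s.classCount W := by
  classical
  refine Finset.card_le_card fun q hq => ?_
  obtain ⟨w, hw, rfl⟩ := Finset.mem_image.1 hq
  obtain ⟨v, hv, hwv⟩ := h w hw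
  exact Finset.mem_image.2 ⟨v, hv, (Quotient.sound hwv).symm⟩

lemma classCount_anti (h : s ≤ t) (W : Finset ν) : t.classCount W ≤ s.classCount W := by
  classical
  have : W.image (Quotient.mk t) = (W.image (Quotient.mk s)).image (Setoid.map_of_le h) := by
    rw [Finset.image_image]; rfl
  unfold classCount
  rw [this]
  exact Finset.card_image_le

lemma classCount_eq_one (hW : W.Nonempty) (h : ∀ x ∈ W, ∀ y ∈ W, s x y) :
    s.classCount W = 1 := by
  classical
  obtain ⟨w, hw⟩ := hW
  refine Finset.card_eq_one.2 ⟨Quotient.mk s w, Finset.eq_singleton_iff_unique_mem.2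
    ⟨Finset.mem_image_of_mem _ hw, fun q hq => ?_⟩⟩
  obtain ⟨v, hv, rfl⟩ := Finset.mem_image.1 hq
  exact Quotient.sound (h v hv w hw)

/-- The equivalence relation that identifies all points of `W`. -/
def identify (W : Finset ν) : Setoid ν where
  r x y := x = y ∨ x ∈ W ∧ y ∈ W
  iseqv :=
    { refl := fun _ => Or.inl rfl
      symm := fun h => h.imp Eq.symm And.symm
      trans := by
        rintro _ _ _ (rfl | ⟨hx, _⟩) (rfl | ⟨hy, hz⟩)
        · exact Or.inl rfl
        · exact Or.inr ⟨hy, hz⟩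
        · exact Or.inr ⟨hx, by assumption⟩
        · exact Or.inr ⟨hx, hz⟩ }

/-- The equivalence relation obtained from `s` by merging the classes of `u` and `v`. -/
def merge (s : Setoid ν) (u v : ν) : Setoid ν where
  r x y := s x y ∨ (s x u ∨ s x v) ∧ (s y u ∨ s y v)
  iseqv :=
    { refl := fun x => Or.inl (s.refl' x)
      symm := fun h => h.imp s.symm' And.symm
      trans := fun h₁ h₂ => by
        rcases h₁ with h₁ | ⟨h₁, h₁'⟩ <;> rcases h₂ with h₂ | ⟨h₂, h₂'⟩
        · exact Or.inl (s.trans' h₁ h₂)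
        · exact Or.inr ⟨h₂.imp (s.trans' h₁) (s.trans' h₁), h₂'⟩
        · exact Or.inr ⟨h₁, h₁'.imp (s.trans' (s.symm' h₂)) (s.trans' (s.symm' h₂))⟩
        · exact Or.inr ⟨h₁, h₂'⟩ }

lemma le_merge (s : Setoid ν) (u v : ν) : s ≤ s.merge u v := fun _ _ h => Or.inl h

lemma merge_rel (s : Setoid ν) (u v : ν) : s.merge u v u v :=
  Or.inr ⟨Or.inl (s.refl' u), Or.inr (s.refl' v)⟩

/-- Once the class of `u` is discarded, passing to merged classes is injective: among the remaining
classes only that of `v` is affected. -/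
lemma classCount_le_merge_add_one (s : Setoid ν) (u v : ν) (W : Finset ν) :
    s.classCount W ≤ (s.merge u v).classCount W + 1 := by
  classical
  unfold classCount
  rw [← Nat.sub_le_iff_le_add]
  refine (Finset.pred_card_le_card_erase (a := Quotient.mk s u)).trans ?_
  refine Finset.card_le_card_of_injOn (Setoid.map_of_le (s.le_merge u v)) ?_ ?_
  · intro q hq
    obtain ⟨w, hw, rfl⟩ := Finset.mem_image.1 (Finset.mem_of_mem_erase hq)
    exact Finset.mem_coe.2 (Finset.mem_image.2 ⟨w, hw, rfl⟩)
  · intro p hp q hq hpq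
    have hp := Finset.ne_of_mem_erase hp
    have hq := Finset.ne_of_mem_erase hq
    induction p using Quotient.inductionOn with
    | h a =>
    induction q using Quotient.inductionOn with
    | h b =>
    have ha : ¬ s a u := fun h => hp (Quotient.sound h)
    have hb : ¬ s b u := fun h => hq (Quotient.sound h)
    have hab : s.merge u v a b := Quotient.exact hpq
    rcases hab with h | ⟨h₁, h₂⟩
    · exact Quotient.sound h
    · exact Quotient.sound (s.trans' (h₁.resolve_left ha) (s.symm' (h₂.resolve_left hb)))

/-- Points of `W' \ W` are alone in their classes, so these classes are distinct and none of them
meets `W`. -/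
lemma classCount_add_card_sdiff_le [DecidableEq ν] (hWW' : W ⊆ W')
    (h : ∀ z ∈ W', z ∉ W → ∀ v, s z v → z = v) :
    s.classCount W + (W' \ W).card ≤ s.classCount W' := by
  classical
  have hinj : ((W' \ W).image (Quotient.mk s)).card = (W' \ W).card := by
    refine Finset.card_image_of_injOn fun a ha b _ hab => ?_
    have ha := Finset.mem_sdiff.1 (Finset.mem_coe.1 ha)
    exact h a ha.1 ha.2 b (Quotient.exact hab)
  unfold classCount
  rw [← hinj, ← Finset.card_union_of_disjoint]
  · refine Finset.card_le_card (Finset.union_subset (Finset.image_subset_image hWW')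
      (Finset.image_subset_image Finset.sdiff_subset))
  · rw [Finset.disjoint_left]
    intro q hq hq'
    obtain ⟨a, ha, rfl⟩ := Finset.mem_image.1 hq
    obtain ⟨b, hb, hab⟩ := Finset.mem_image.1 hq'
    have hb := Finset.mem_sdiff.1 hb
    have := h b hb.1 hb.2 a (Quotient.exact hab)
    exact hb.2 (this ▸ ha)

end Setoid

end ClassCount

/-! ### Merging vertices along edges -/

namespace Graph

variable {ν ε : Type*} {G : Graph ν ε}

/-- The equivalence relation on vertices generated by the edges in `A`. -/
def linkSetoid (G : Graph ν ε) (A : Finset ε) : Setoid ν :=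
  Relation.EqvGen.setoid fun x y => ∃ e ∈ A, G.IsLink e x y

lemma linkSetoid_le {A : Finset ε} {s : Setoid ν} :
    G.linkSetoid A ≤ s ↔ ∀ e ∈ A, ∀ x y, G.IsLink e x y → s x y :=
  ⟨fun h e he _ _ hxy => h (Relation.EqvGen.rel _ _ ⟨e, he, hxy⟩),
    fun h => Setoid.eqvGen_le fun _ _ ⟨e, he, hxy⟩ => h e he _ _ hxy⟩

lemma IsLink.linkSetoid {A : Finset ε} {e : ε} (he : e ∈ A) {x y : ν} (h : G.IsLink e x y) :
    G.linkSetoid A x y :=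
  Relation.EqvGen.rel _ _ ⟨e, he, h⟩

lemma linkSetoid_union_le [DecidableEq ε] (A B : Finset ε) :
    G.linkSetoid (A ∪ B) ≤ G.linkSetoid A ⊔ G.linkSetoid B := by
  refine linkSetoid_le.2 fun e he x y hxy => ?_
  rcases Finset.mem_union.1 he with he | he
  · exact (le_sup_left : G.linkSetoid A ≤ _) (hxy.linkSetoid he)
  · exact (le_sup_right : G.linkSetoid B ≤ _) (hxy.linkSetoid he)

lemma linkSetoid_empty : G.linkSetoid ∅ = ⊥ :=
  le_bot_iff.1 (linkSetoid_le.2 fun _ he => absurd he (Finset.notMem_empty _))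

/-- Each edge merges at most two classes, hence costs at most one. -/
lemma classCount_le_sup_linkSetoid_add_card (G : Graph ν ε) (s : Setoid ν) (W : Finset ν)
    (F : Finset ε) : s.classCount W ≤ (s ⊔ G.linkSetoid F).classCount W + F.card := by
  classical
  induction F using Finset.induction_on with
  | empty => simp [linkSetoid_empty]
  | insert e F he ih =>
    rw [Finset.card_insert_of_notMem he]
    suffices h : (s ⊔ G.linkSetoid F).classCount W
        ≤ (s ⊔ G.linkSetoid (insert e F)).classCount W + 1 by omega
    by_cases hex : ∃ u v, G.IsLink e u v
    · obtain ⟨u, v, huv⟩ := hex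
      refine ((s ⊔ G.linkSetoid F).classCount_le_merge_add_one u v W).trans ?_
      refine Nat.add_le_add_right (Setoid.classCount_anti (sup_le
        (le_sup_left.trans (Setoid.le_merge _ u v)) (linkSetoid_le.2 fun f hf x y hxy => ?_)) W) 1
      rcases Finset.mem_insert.1 hf with rfl | hf
      · rcases huv.eq_and_eq_or_eq_and_eq hxy with ⟨rfl, rfl⟩ | ⟨rfl, rfl⟩
        · exact Setoid.merge_rel _ _ _
        · exact Setoid.symm' _ (Setoid.merge_rel _ _ _)
      · exact Setoid.le_merge _ u v
          ((le_sup_right : G.linkSetoid F ≤ s ⊔ G.linkSetoid F) (hxy.linkSetoid hf))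
    · refine (Setoid.classCount_anti (sup_le le_sup_left (linkSetoid_le.2 fun f hf x y hxy => ?_))
        W).trans (Nat.le_succ _)
      rcases Finset.mem_insert.1 hf with rfl | hf
      · exact absurd ⟨x, y, hxy⟩ hex
      · exact (le_sup_right : G.linkSetoid F ≤ s ⊔ G.linkSetoid F) (hxy.linkSetoid hf)

end Graph

lemma Finset.sum_le_sum_of_injOn_sigma {α β γ δ : Type*} {s : Finset α} {a : Finset β}
    {b : β → Finset γ} {c : β → Finset δ} {f : α → ℝ} {h : β → γ → δ → ℝ}
    (φ : α → β) (ψ : α → γ) (χ : α → δ)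
    (hφ : ∀ x ∈ s, φ x ∈ a ∧ ψ x ∈ b (φ x) ∧ χ x ∈ c (φ x))
    (hinj : ∀ x ∈ s, ∀ y ∈ s, φ x = φ y → ψ x = ψ y → χ x = χ y → x = y)
    (hle : ∀ x ∈ s, f x ≤ h (φ x) (ψ x) (χ x))
    (h0 : ∀ x ∈ a, ∀ y ∈ b x, ∀ z ∈ c x, 0 ≤ h x y z) :
    ∑ x ∈ s, f x ≤ ∑ x ∈ a, ∑ y ∈ b x, ∑ z ∈ c x, h x y z := by
  classical
  have hR : ∑ x ∈ a, ∑ y ∈ b x, ∑ z ∈ c x, h x y z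
      = ∑ p ∈ a.sigma fun x => b x ×ˢ c x, h p.1 p.2.1 p.2.2 := by
    rw [Finset.sum_sigma]
    exact Finset.sum_congr rfl fun x _ => (Finset.sum_product' _ _ _).symm
  rw [hR]
  let θ : α → Σ _ : β, γ × δ := fun x => ⟨φ x, (ψ x, χ x)⟩
  calc ∑ x ∈ s, f x ≤ ∑ x ∈ s, h (θ x).1 (θ x).2.1 (θ x).2.2 := Finset.sum_le_sum hle
    _ = ∑ p ∈ s.image θ, h p.1 p.2.1 p.2.2 := by
        refine (Finset.sum_image (f := fun p : Σ _ : β, γ × δ => h p.1 p.2.1 p.2.2)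
          fun x hx y hy hxy => ?_).symm
        have h₁ : φ x = φ y := congrArg Sigma.fst hxy
        have h₂ : ψ x = ψ y := congrArg (fun p => p.2.1) hxy
        have h₃ : χ x = χ y := congrArg (fun p => p.2.2) hxy
        exact hinj x hx y hy h₁ h₂ h₃
    _ ≤ _ := by
        refine Finset.sum_le_sum_of_subset_of_nonneg (fun p hp => ?_) fun p hp _ => ?_
        · obtain ⟨x, hx, rfl⟩ := Finset.mem_image.1 hp
          obtain ⟨h₁, h₂, h₃⟩ := hφ x hx
          exact Finset.mem_sigma.2 ⟨h₁, Finset.mem_product.2 ⟨h₂, h₃⟩⟩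
        · obtain ⟨h₁, h₂⟩ := Finset.mem_sigma.1 hp
          obtain ⟨h₂, h₃⟩ := Finset.mem_product.1 h₂
          exact h0 _ h₁ _ h₂ _ h₃

/-! ### Rooted edge sets and their splitting along a cut -/

namespace Graph

variable {ν ε : Type*} {G : Graph ν ε}

/-- `y` can be reached from `x` along edges in `A` whose ends lie outside `D`. -/
def Reach (G : Graph ν ε) (A : Finset ε) (D : Set ν) : ν → ν → Prop :=
  Relation.ReflTransGen fun x y => ∃ e ∈ A, G.IsLink e x y ∧ x ∉ D ∧ y ∉ D

lemma Reach.linkSetoid {A : Finset ε} {D : Set ν} {x y : ν} (h : G.Reach A D x y) :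
    G.linkSetoid A x y := by
  induction h with
  | refl => exact Setoid.refl' _ _
  | tail _ h ih =>
    obtain ⟨e, he, hxy, -⟩ := h
    exact Setoid.trans' _ ih (hxy.linkSetoid he)

/-- The edge set `A` spans a subgraph rooted at `Y` all of whose pendant parts meet `X ∪ Y`: every
vertex is joined to `Y`, and after the deletion of any vertex it is still joined to `X ∪ Y`. -/
structure IsRooted (G : Graph ν ε) (X Y : Finset ν) (A : Finset ε) : Prop where
  exists_reach : ∀ z, (z ∈ X ∨ ∃ e ∈ A, G.Inc e z) → ∃ y ∈ Y, G.Reach A ∅ z y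
  exists_reach_avoiding : ∀ c z, z ≠ c → (∃ e ∈ A, G.Inc e z) →
    ∃ v, (v ∈ X ∨ v ∈ Y) ∧ v ≠ c ∧ G.Reach A {c} z v

/-- All ends of the edge `e` lie in `S`. -/
def EndsIn (G : Graph ν ε) (S : Set ν) (e : ε) : Prop := ∀ v, G.Inc e v → v ∈ S

lemma cutEdges_compl (G : Graph ν ε) (S : Set ν) : G.cutEdges Sᶜ = G.cutEdges S := by
  ext e
  constructor
  · rintro ⟨x, y, h, hx, hy⟩
    exact ⟨y, x, h.symm, not_not.1 hy, hx⟩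
  · rintro ⟨x, y, h, hx, hy⟩
    exact ⟨y, x, h.symm, hy, not_not.2 hx⟩

lemma mem_cutEdges_or_endsIn (S : Set ν) (e : ε) :
    e ∈ G.cutEdges S ∨ G.EndsIn Sᶜ e ∨ G.EndsIn S e := by
  by_cases hc : e ∈ G.cutEdges S
  · exact Or.inl hc
  by_cases hi : G.EndsIn Sᶜ e
  · exact Or.inr (Or.inl hi)
  refine Or.inr (Or.inr ?_)
  simp only [EndsIn, not_forall] at hi
  obtain ⟨x, hx, hxS⟩ := hi
  rw [Set.mem_compl_iff, not_not] at hxS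
  intro v hv
  by_contra hvS
  obtain ⟨u, hu⟩ := hx
  rcases hv.eq_or_eq_of_isLink hu with rfl | rfl
  · exact hvS hxS
  · exact hc ⟨x, v, hu, hxS, hvS⟩

open Classical in
-- Follow the walk until it first leaves `S`. The edge on which it leaves is a cut edge, and `u` is
-- the end of that edge in `S`.
lemma Reach.exists_reach_filter {A : Finset ε} {D S : Set ν} {z v : ν} (h : G.Reach A D z v)
    (hz : z ∈ S) : ∃ u ∈ S, G.Reach (A.filter (G.EndsIn S)) D z u ∧
      (u = v ∨ (u ∉ D ∧ ∃ e ∈ A, e ∈ G.cutEdges S ∧ G.Inc e u)) := by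
  induction h using Relation.ReflTransGen.head_induction_on with
  | refl => exact ⟨v, hz, .refl, Or.inl rfl⟩
  | @head x y h _ ih =>
    obtain ⟨e, he, hxy, hx, hy⟩ := h
    by_cases hyS : y ∈ S
    · obtain ⟨u, hu, hyu, huv⟩ := ih hyS
      refine ⟨u, hu, .head ⟨e, Finset.mem_filter.2 ⟨he, fun w hw => ?_⟩, hxy, hx, hy⟩ hyu, huv⟩
      rcases hw.eq_or_eq_of_isLink hxy with rfl | rfl <;> assumption
    · exact ⟨x, hz, .refl, Or.inr ⟨hx, e, he, ⟨x, y, hxy, hz, hyS⟩, hxy.inc_left⟩⟩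

open Classical in
-- A walk to its target either stays in `S` or can be stopped at an end of a cut edge, which is why
-- these ends have to become roots.
lemma IsRooted.restrict {X Y X' Y' : Finset ν} {A : Finset ε} {S : Set ν} (h : G.IsRooted X Y A)
    (hX' : ∀ x, x ∈ X' ↔ x ∈ X ∧ x ∈ S) (hY' : ∀ y ∈ Y, y ∈ S → y ∈ Y')
    (hcut : ∀ y ∈ S, (∃ e ∈ A, e ∈ G.cutEdges S ∧ G.Inc e y) → y ∈ Y') :
    G.IsRooted X' Y' (A.filter (G.EndsIn S)) where
  exists_reach z hz := by
    have hzS : z ∈ S := by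
      rcases hz with hz | ⟨e, he, hez⟩
      · exact ((hX' z).1 hz).2
      · exact (Finset.mem_filter.1 he).2 z hez
    obtain ⟨y, hy, hzy⟩ := h.exists_reach z (hz.imp (fun h => ((hX' z).1 h).1)
      fun ⟨e, he, hez⟩ => ⟨e, (Finset.mem_filter.1 he).1, hez⟩)
    obtain ⟨u, hu, hzu, huv⟩ := hzy.exists_reach_filter hzS
    refine ⟨u, ?_, hzu⟩
    rcases huv with rfl | ⟨-, huv⟩
    · exact hY' u hy hu
    · exact hcut u hu huv
  exists_reach_avoiding c z hzc hz := by
    obtain ⟨e, he, hez⟩ := hz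
    obtain ⟨heA, heS⟩ := Finset.mem_filter.1 he
    obtain ⟨v, hv, hvc, hzv⟩ := h.exists_reach_avoiding c z hzc ⟨e, heA, hez⟩
    obtain ⟨u, hu, hzu, huv⟩ := hzv.exists_reach_filter (heS z hez)
    rcases huv with rfl | ⟨huc, huv⟩
    · exact ⟨u, hv.imp (fun h => (hX' u).2 ⟨h, hu⟩) (fun h => hY' u h hu), hvc, hzu⟩
    · exact ⟨u, Or.inr (hcut u hu huv), huc, hzu⟩

open Classical in
/-- The total weight of the rooted edge sets `A ⊆ E`, each of them weighted by `α ^ (-b)` where `b`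
is the number of classes of `s` that meet `W` after the ends of the edges in `A` are merged. -/
noncomputable def rootedSum (G : Graph ν ε) (t : ε → ℝ) (α : ℝ) (E : Finset ε) (X Y W : Finset ν)
    (s : Setoid ν) : ℝ :=
  ∑ A ∈ E.powerset with G.IsRooted X Y A,
    (∏ e ∈ A, t e) * α ^ (-((s ⊔ G.linkSetoid A).classCount W : ℤ))

open Classical in
/-- The vertices of `Y` in `S`, and the vertices in `V ∩ S` incident with an edge in `F`. -/
noncomputable def addEnds (G : Graph ν ε) (V Y : Finset ν) (S : Set ν) (F : Finset ε) : Finset ν :=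
  Y.filter (· ∈ S) ∪ V.filter fun v => v ∈ S ∧ ∃ e ∈ F, G.Inc e v

open Classical in
lemma mem_addEnds {V Y : Finset ν} {S : Set ν} {F : Finset ε} {v : ν} :
    v ∈ G.addEnds V Y S F ↔ v ∈ S ∧ (v ∈ Y ∨ (v ∈ V ∧ ∃ e ∈ F, G.Inc e v)) := by
  simp only [addEnds, Finset.mem_union, Finset.mem_filter]
  tauto

section Split

variable {t : ε → ℝ} {α : ℝ} {E : Finset ε} {V X Y W : Finset ν} {S : Set ν} {s : Setoid ν}

open Classical in
-- An edge set is determined by its cut edges and its two sides. Enlarging `W` by the new roots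
-- creates no further classes, because a rooted `A` already joins them to `Y ⊆ W`.
lemma rootedSum_le_sum_cut (ht : ∀ e, 0 ≤ t e) (hα : 1 < α)
    (hEV : ∀ e ∈ E, ∀ v, G.Inc e v → v ∈ V) (hEG : ∀ e ∈ E, e ∈ E(G)) (hYW : Y ⊆ W) :
    G.rootedSum t α E X Y W s ≤ ∑ F ∈ (E.filter (· ∈ G.cutEdges S)).powerset,
      ∑ B ∈ (E.filter (G.EndsIn Sᶜ)).powerset with
          G.IsRooted (X.filter (· ∈ Sᶜ)) (G.addEnds V Y Sᶜ F) B,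
        ∑ C ∈ (E.filter (G.EndsIn S)).powerset with
            G.IsRooted (X.filter (· ∈ S)) (G.addEnds V Y S F) C,
          (∏ e ∈ F, t e) * ((∏ e ∈ B, t e) * ((∏ e ∈ C, t e) *
            α ^ (-((((s ⊔ G.linkSetoid F) ⊔ G.linkSetoid B) ⊔ G.linkSetoid C).classCount
              (W ∪ G.addEnds V Y S F ∪ G.addEnds V Y Sᶜ F) : ℤ)))) := by
  have hα0 : 0 < α := zero_lt_one.trans hα
  have hsplit : ∀ A ⊆ E, A = A.filter (· ∈ G.cutEdges S) ∪ A.filter (G.EndsIn Sᶜ) ∪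
      A.filter (G.EndsIn S) := by
    intro A _
    ext e
    simp only [Finset.mem_union, Finset.mem_filter]
    have := G.mem_cutEdges_or_endsIn S e
    tauto
  unfold rootedSum
  refine Finset.sum_le_sum_of_injOn_sigma (fun A => A.filter (· ∈ G.cutEdges S))
    (fun A => A.filter (G.EndsIn Sᶜ)) (fun A => A.filter (G.EndsIn S)) ?_ ?_ ?_ ?_
  · intro A hA
    obtain ⟨hAE, hA⟩ := Finset.mem_filter.1 hA
    rw [Finset.mem_powerset] at hAE
    refine ⟨Finset.mem_powerset.2 (Finset.filter_subset_filter _ hAE),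
      Finset.mem_filter.2 ⟨Finset.mem_powerset.2 (Finset.filter_subset_filter _ hAE), ?_⟩,
      Finset.mem_filter.2 ⟨Finset.mem_powerset.2 (Finset.filter_subset_filter _ hAE), ?_⟩⟩
    · refine hA.restrict (by simp) (fun y hy hyS => mem_addEnds.2 ⟨hyS, Or.inl hy⟩) ?_
      rintro y hyS ⟨e, he, hec, hey⟩
      rw [cutEdges_compl] at hec
      exact mem_addEnds.2 ⟨hyS, Or.inr ⟨hEV e (hAE he) y hey, e, Finset.mem_filter.2 ⟨he, hec⟩,
        hey⟩⟩
    · refine hA.restrict (by simp) (fun y hy hyS => mem_addEnds.2 ⟨hyS, Or.inl hy⟩) ?_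
      rintro y hyS ⟨e, he, hec, hey⟩
      exact mem_addEnds.2 ⟨hyS, Or.inr ⟨hEV e (hAE he) y hey, e, Finset.mem_filter.2 ⟨he, hec⟩,
        hey⟩⟩
  · intro A hA B hB h₁ h₂ h₃
    rw [hsplit A (Finset.mem_powerset.1 (Finset.mem_filter.1 hA).1),
      hsplit B (Finset.mem_powerset.1 (Finset.mem_filter.1 hB).1)]
    rw [h₁, h₂, h₃]
  · intro A hA
    obtain ⟨hAE, hA⟩ := Finset.mem_filter.1 hA
    rw [Finset.mem_powerset] at hAE
    have hprod : ∏ e ∈ A, t e = (∏ e ∈ A.filter (· ∈ G.cutEdges S), t e) *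
        ((∏ e ∈ A.filter (G.EndsIn Sᶜ), t e) * ∏ e ∈ A.filter (G.EndsIn S), t e) := by
      conv_lhs => rw [hsplit A hAE]
      rw [Finset.prod_union, Finset.prod_union, mul_assoc]
      · rw [Finset.disjoint_left]
        intro e he he'
        obtain ⟨-, x, y, hxy, hx, hy⟩ := Finset.mem_filter.1 he
        exact (Finset.mem_filter.1 he').2 x hxy.inc_left hx
      · rw [Finset.disjoint_left]
        intro e he he'
        obtain ⟨heA, heS⟩ := Finset.mem_filter.1 he'
        rcases Finset.mem_union.1 he with he | he
        · obtain ⟨-, x, y, hxy, hx, hy⟩ := Finset.mem_filter.1 he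
          exact hy (heS y hxy.inc_right)
        -- Without an end, `e` would vacuously lie on both sides; membership in `E(G)` supplies one.
        · obtain ⟨x, y, hxy⟩ := exists_isLink_of_mem_edgeSet (hEG e (hAE heA))
          exact (Finset.mem_filter.1 he).2 x hxy.inc_left (heS x hxy.inc_left)
    rw [hprod, mul_assoc, mul_assoc]
    refine mul_le_mul_of_nonneg_left (mul_le_mul_of_nonneg_left (mul_le_mul_of_nonneg_left ?_
      (Finset.prod_nonneg fun e _ => ht e)) (Finset.prod_nonneg fun e _ => ht e))
      (Finset.prod_nonneg fun e _ => ht e)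
    refine zpow_le_zpow_right₀ hα.le (neg_le_neg (Int.ofNat_le.2 ?_))
    refine le_trans (Setoid.classCount_anti (s := s ⊔ G.linkSetoid A) ?_ _)
      (Setoid.classCount_le_of_forall_exists ?_)
    · rw [sup_assoc, sup_assoc]
      refine sup_le_sup_left ?_ s
      rw [← sup_assoc]
      conv_lhs => rw [hsplit A hAE]
      exact (linkSetoid_union_le _ _).trans (sup_le_sup_right (linkSetoid_union_le _ _) _)
    · intro v hv
      by_cases hvW : v ∈ W
      · exact ⟨v, hvW, Setoid.refl' _ _⟩
      have : ∃ e ∈ A, G.Inc e v := by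
        simp only [Finset.mem_union, mem_addEnds, hvW, false_or] at hv
        rcases hv with ⟨-, hv | ⟨-, e, he, hev⟩⟩ | ⟨-, hv | ⟨-, e, he, hev⟩⟩
        · exact absurd (hYW hv) hvW
        · exact ⟨e, (Finset.mem_filter.1 he).1, hev⟩
        · exact absurd (hYW hv) hvW
        · exact ⟨e, (Finset.mem_filter.1 he).1, hev⟩
      obtain ⟨y, hy, hvy⟩ := hA.exists_reach v (Or.inr this)
      exact ⟨y, hYW hy, (le_sup_right : G.linkSetoid A ≤ s ⊔ G.linkSetoid A) hvy.linkSetoid⟩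
  · intro F _ B _ C _
    have h : ∀ A : Finset ε, 0 ≤ ∏ e ∈ A, t e := fun A => Finset.prod_nonneg fun e _ => ht e
    exact mul_nonneg (h F) (mul_nonneg (h B) (mul_nonneg (h C) (zpow_nonneg hα0.le _)))

end Split

end Graph

/-! ### The inductive bound for rooted edge sets -/

lemma Setoid.eq_of_sup_rel {ν : Type*} {s t : Setoid ν} {z : ν} (hs : ∀ v, s z v → z = v)
    (ht : ∀ v, t z v → z = v) : ∀ v, (s ⊔ t) z v → z = v := by
  -- Both relations refine the partition into `{z}` and its complement, hence so does their join.
  have key : ∀ r : Setoid ν, (∀ v, r z v → z = v) → r ≤ Setoid.ker (· = z) := by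
    intro r hr x y hxy
    refine propext ⟨?_, ?_⟩
    · rintro rfl
      exact (hr y hxy).symm
    · rintro rfl
      exact (hr x (r.symm' hxy)).symm
  intro v hv
  have h : (z = z) = (v = z) := sup_le (key s hs) (key t ht) hv
  exact (h.mp rfl).symm

namespace Graph

variable {ν ε : Type*} {G : Graph ν ε}

lemma eq_of_linkSetoid_rel {A : Finset ε} {z : ν} (h : ∀ e ∈ A, ¬ G.Inc e z) :
    ∀ v, G.linkSetoid A z v → z = v := by
  have : G.linkSetoid A ≤ Setoid.ker (· = z) := linkSetoid_le.2 fun e he x y hxy => by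
    have hx : x ≠ z := by rintro rfl; exact h e he hxy.inc_left
    have hy : y ≠ z := by rintro rfl; exact h e he hxy.inc_right
    simp [Setoid.ker_def, hx, hy]
  intro v hv
  have h : (z = z) = (v = z) := this hv
  exact (h.mp rfl).symm

/-- The sum factors as `∏ (1 + α * t e)`, and `1 + x ≤ exp x`. The constant `log α / α` is chosen to
make the result exactly `α`. -/
lemma sum_powerset_prod_mul_pow_le {t : ε → ℝ} (ht : ∀ e, 0 ≤ t e) {α : ℝ} (hα : 1 < α)
    {K : Finset ε} (hK : ∑ e ∈ K, t e ≤ Real.log α / α) :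
    ∑ F ∈ K.powerset, (∏ e ∈ F, t e) * α ^ F.card ≤ α := by
  have hα0 : 0 < α := zero_lt_one.trans hα
  calc ∑ F ∈ K.powerset, (∏ e ∈ F, t e) * α ^ F.card
      = ∑ F ∈ K.powerset, ∏ e ∈ F, t e * α := by
        refine Finset.sum_congr rfl fun F _ => ?_
        rw [Finset.prod_mul_distrib, Finset.prod_const]
    _ = ∏ e ∈ K, (1 + t e * α) := (Finset.prod_one_add K).symm
    _ ≤ ∏ e ∈ K, Real.exp (t e * α) := by
        refine Finset.prod_le_prod (fun e _ => by have := ht e; positivity) fun e _ => ?_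
        rw [add_comm]
        exact Real.add_one_le_exp _
    _ = Real.exp ((∑ e ∈ K, t e) * α) := by rw [← Real.exp_sum, Finset.sum_mul]
    _ ≤ Real.exp (Real.log α) :=
        Real.exp_le_exp.2 ((le_div_iff₀ hα0).1 hK)
    _ = α := Real.exp_log hα0

lemma rootedSum_eq_zero {t : ε → ℝ} {α : ℝ} {E : Finset ε} {X W : Finset ν} {s : Setoid ν} {x : ν}
    (hx : x ∈ X) : G.rootedSum t α E X ∅ W s = 0 := by
  classical
  refine Finset.sum_eq_zero fun A hA => ?_
  obtain ⟨y, hy, -⟩ := (Finset.mem_filter.1 hA).2.exists_reach x (Or.inl hx)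
  exact absurd hy (Finset.notMem_empty y)

section

variable {t : ε → ℝ} {α : ℝ}

/-- Base case: only `A = ∅` is rooted. An edge is not a loop, so it has an end other than `y`, and
after deletion of `y` this end has nothing in `X ∪ Y` left to reach. -/
lemma rootedSum_singleton_le (hG : G.Loopless) (hα : 1 < α) {E : Finset ε} {X Y W : Finset ν}
    {s : Setoid ν} {y : ν} (hEG : ∀ e ∈ E, e ∈ E(G)) (hY : y ∈ Y) (hYy : ∀ v ∈ Y, v = y)
    (hXy : ∀ v ∈ X, v = y) :
    G.rootedSum t α E X Y W s ≤ α ^ ((Y.card : ℤ) - s.classCount W - 1) := by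
  classical
  have hα0 : 0 < α := zero_lt_one.trans hα
  have hempty : ∀ A ⊆ E, G.IsRooted X Y A → A = ∅ := by
    intro A hAE hA
    refine Finset.eq_empty_of_forall_notMem fun e he => ?_
    obtain ⟨u, v, huv⟩ := exists_isLink_of_mem_edgeSet (hEG e (hAE he))
    obtain ⟨z, hzy, hz⟩ : ∃ z, z ≠ y ∧ G.Inc e z := by
      by_cases h : u = y
      · exact ⟨v, fun h' => huv.ne (h.trans h'.symm), huv.inc_right⟩
      · exact ⟨u, h, huv.inc_left⟩
    obtain ⟨v, hv, hvy, -⟩ := hA.exists_reach_avoiding y z hzy ⟨e, he, hz⟩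
    exact hvy (hv.elim (hXy v) (hYy v))
  have hcard : Y.card = 1 :=
    Finset.card_eq_one.2 ⟨y, Finset.eq_singleton_iff_unique_mem.2 ⟨hY, hYy⟩⟩
  calc G.rootedSum t α E X Y W s
      ≤ ∑ A ∈ {(∅ : Finset ε)}, (∏ e ∈ A, t e) *
          α ^ (-((s ⊔ G.linkSetoid A).classCount W : ℤ)) := by
        refine Finset.sum_le_sum_of_subset_of_nonneg (fun A hA => ?_) fun A hA _ => ?_
        · obtain ⟨hAE, hA⟩ := Finset.mem_filter.1 hA
          exact Finset.mem_singleton.2 (hempty A (Finset.mem_powerset.1 hAE) hA)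
        · rw [Finset.mem_singleton.1 hA]
          rw [Finset.prod_empty, one_mul]
          exact zpow_nonneg hα0.le _
    _ = α ^ (-(s.classCount W : ℤ)) := by simp [linkSetoid_empty]
    _ = _ := by rw [hcard]; congr 1; push_cast; ring

open Classical in
-- Every new root is a class of its own under `s`, so it raises the class count by one; merging
-- along `F` then lowers the count by at most `|F|`. Thus the new roots cost `|F|` in total, not
-- `2|F|`.
lemma card_addEnds_add_card_addEnds_le {V Y W : Finset ν} {S : Set ν} {F : Finset ε} {s : Setoid ν}
    (hYV : Y ⊆ V) (hYW : Y ⊆ W) (hWV : ∀ v ∈ W, v ∈ V → v ∈ Y)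
    (hs : ∀ z ∈ V, z ∉ Y → ∀ v, s z v → z = v) :
    (G.addEnds V Y S F).card + (G.addEnds V Y Sᶜ F).card + s.classCount W ≤
      (s ⊔ G.linkSetoid F).classCount (W ∪ G.addEnds V Y S F ∪ G.addEnds V Y Sᶜ F) + F.card
        + Y.card := by
  set W' := W ∪ G.addEnds V Y S F ∪ G.addEnds V Y Sᶜ F with hW'
  have hWW' : W ⊆ W' := Finset.subset_union_left.trans Finset.subset_union_left
  have hV : ∀ T : Set ν, ∀ v ∈ G.addEnds V Y T F, v ∈ V := fun T v hv => by
    rcases (mem_addEnds.1 hv).2 with h | h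
    exacts [hYV h, h.1]
  have h₁ : s.classCount W + (W' \ W).card ≤ s.classCount W' := by
    refine Setoid.classCount_add_card_sdiff_le hWW' fun z hz hzW => hs z ?_ fun h => hzW (hYW h)
    simp only [hW', Finset.mem_union, hzW, false_or] at hz
    exact hz.elim (hV _ z) (hV _ z)
  have h₂ := G.classCount_le_sup_linkSetoid_add_card s W' F
  have h₃ : (G.addEnds V Y S F).card + (G.addEnds V Y Sᶜ F).card ≤ Y.card + (W' \ W).card := by
    rw [← Finset.card_union_of_disjoint]
    · refine (Finset.card_le_card (t := Y ∪ (W' \ W)) fun v hv => ?_).trans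
        (Finset.card_union_le _ _)
      by_cases hvW : v ∈ W
      · refine Finset.mem_union_left _ (hWV v hvW ?_)
        exact (Finset.mem_union.1 hv).elim (hV _ v) (hV _ v)
      · refine Finset.mem_union_right _ (Finset.mem_sdiff.2 ⟨?_, hvW⟩)
        rw [hW', Finset.union_assoc]
        exact Finset.mem_union_right _ hv
    · rw [Finset.disjoint_left]
      exact fun v hv hv' => (mem_addEnds.1 hv').1 (mem_addEnds.1 hv).1
  omega

open Classical in
/-- The bound for the total weight of the rooted edge sets, if any two vertices of `V` are separated
by a cut of total weight at most `log α / α`. -/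
theorem rootedSum_le (hG : G.Loopless) (hα : 1 < α) (ht : ∀ e, 0 ≤ t e) (V : Finset ν) :
    ∀ (E : Finset ε) (X Y W : Finset ν) (s : Setoid ν), (∀ e ∈ E, ∀ v, G.Inc e v → v ∈ V) →
      (∀ e ∈ E, e ∈ E(G)) →
      (∀ x ∈ V, ∀ y ∈ V, x ≠ y → ∃ S : Set ν, x ∈ S ∧ y ∉ S ∧
        ∑ e ∈ E with e ∈ G.cutEdges S, t e ≤ Real.log α / α) →
      X ⊆ V → Y ⊆ V → Y.Nonempty → Y ⊆ W → (∀ v ∈ W, v ∈ V → v ∈ Y) →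
      (∀ z ∈ V, z ∉ Y → ∀ v, s z v → z = v) →
      G.rootedSum t α E X Y W s ≤ α ^ ((Y.card : ℤ) - s.classCount W - 1) := by
  have hα0 : 0 < α := zero_lt_one.trans hα
  induction V using Finset.strongInduction with
  | H V ih =>
  intro E X Y W s hEV hEG hcut hXV hYV hYne hYW hWV hs
  -- If this fails, `X ∪ Y` is a single point. Otherwise the cut leaves a point of `X ∪ Y` on each
  -- side, and both sides have fewer vertices.
  by_cases hsep : ∃ z₁ z₂, (z₁ ∈ X ∨ z₁ ∈ Y) ∧ z₂ ∈ Y ∧ z₁ ≠ z₂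
  swap
  · push Not at hsep
    obtain ⟨y, hy⟩ := hYne
    exact rootedSum_singleton_le hG hα hEG hy (fun v hv => hsep v y (Or.inr hv) hy)
      fun v hv => hsep v y (Or.inl hv) hy
  obtain ⟨z₁, z₂, hz₁, hz₂, hz⟩ := hsep
  have hz₁V : z₁ ∈ V := hz₁.elim (fun h => hXV h) fun h => hYV h
  have hz₂V : z₂ ∈ V := hYV hz₂
  obtain ⟨S, hz₁S, hz₂S, hS⟩ := hcut z₁ hz₁V z₂ hz₂V hz
  -- the induction hypothesis for one side `T` of the cut
  have side : ∀ T : Set ν, (∃ z ∈ V, z ∉ T) → (∃ z ∈ T, z ∈ X ∨ z ∈ Y) → ∀ (F : Finset ε)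
      (W' : Finset ν) (τ : Setoid ν), G.addEnds V Y T F ⊆ W' →
      (∀ v ∈ W', v ∈ V → v ∈ T → v ∈ G.addEnds V Y T F) →
      (∀ z ∈ V, z ∈ T → z ∉ G.addEnds V Y T F → ∀ v, τ z v → z = v) →
      G.rootedSum t α (E.filter (G.EndsIn T)) (X.filter (· ∈ T)) (G.addEnds V Y T F) W' τ
        ≤ α ^ (((G.addEnds V Y T F).card : ℤ) - τ.classCount W' - 1) := by
    intro T hVT hT F W' τ h₁ h₂ h₃
    -- A side without roots still contains a point of `X`, which nothing can join to a root, so its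
    -- sum is zero.
    rcases (G.addEnds V Y T F).eq_empty_or_nonempty with he | hne
    · obtain ⟨z, hzT, hz⟩ := hT
      rw [he, rootedSum_eq_zero (x := z)]
      · exact zpow_nonneg hα0.le _
      · refine Finset.mem_filter.2 ⟨hz.resolve_right fun hzY => ?_, hzT⟩
        exact Finset.notMem_empty z (he ▸ mem_addEnds.2 ⟨hzT, Or.inl hzY⟩)
    · refine ih (V.filter (· ∈ T)) ?_ _ _ _ _ _ ?_ ?_ ?_ ?_ ?_ hne h₁ ?_ ?_
      · obtain ⟨z, hzV, hzT⟩ := hVT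
        exact Finset.filter_ssubset.2 ⟨z, hzV, hzT⟩
      · intro e he v hv
        obtain ⟨heE, heT⟩ := Finset.mem_filter.1 he
        exact Finset.mem_filter.2 ⟨hEV e heE v hv, heT v hv⟩
      · exact fun e he => hEG e (Finset.mem_filter.1 he).1
      · intro x hx y hy hxy
        obtain ⟨R, hxR, hyR, hR⟩ := hcut x (Finset.mem_filter.1 hx).1 y (Finset.mem_filter.1 hy).1
          hxy
        exact ⟨R, hxR, hyR, (Finset.sum_le_sum_of_subset_of_nonneg (Finset.filter_subset_filter _
          (Finset.filter_subset _ _)) fun e _ _ => ht e).trans hR⟩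
      · exact Finset.filter_subset_filter _ hXV
      · intro v hv
        obtain ⟨hvT, hv⟩ := mem_addEnds.1 hv
        exact Finset.mem_filter.2 ⟨hv.elim (fun h => hYV h) fun h => h.1, hvT⟩
      · exact fun v hv hvV => h₂ v hv (Finset.mem_filter.1 hvV).1 (Finset.mem_filter.1 hvV).2
      · exact fun z hz => h₃ z (Finset.mem_filter.1 hz).1 (Finset.mem_filter.1 hz).2
  have hisol : ∀ T : Set ν, ∀ F : Finset ε, ∀ z ∈ V, z ∈ T → z ∉ G.addEnds V Y T F →
      ∀ v, (s ⊔ G.linkSetoid F) z v → z = v := by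
    intro T F z hzV hzT hz
    refine Setoid.eq_of_sup_rel (hs z hzV fun h => hz (mem_addEnds.2 ⟨hzT, Or.inl h⟩)) ?_
    exact eq_of_linkSetoid_rel fun e he hez => hz (mem_addEnds.2 ⟨hzT, Or.inr ⟨hzV, e, he, hez⟩⟩)
  set n : ℤ := (Y.card : ℤ) - s.classCount W - 1 with hn
  refine (rootedSum_le_sum_cut (S := S) ht hα hEV hEG hYW).trans ?_
  have hF : ∀ F ∈ (E.filter (· ∈ G.cutEdges S)).powerset,
      ∑ B ∈ (E.filter (G.EndsIn Sᶜ)).powerset with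
          G.IsRooted (X.filter (· ∈ Sᶜ)) (G.addEnds V Y Sᶜ F) B,
        ∑ C ∈ (E.filter (G.EndsIn S)).powerset with
            G.IsRooted (X.filter (· ∈ S)) (G.addEnds V Y S F) C,
          (∏ e ∈ F, t e) * ((∏ e ∈ B, t e) * ((∏ e ∈ C, t e) *
            α ^ (-((((s ⊔ G.linkSetoid F) ⊔ G.linkSetoid B) ⊔ G.linkSetoid C).classCount
              (W ∪ G.addEnds V Y S F ∪ G.addEnds V Y Sᶜ F) : ℤ)))) ≤
        (∏ e ∈ F, t e) * α ^ F.card * α ^ (n - 1) := by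
    intro F _
    set W' := W ∪ G.addEnds V Y S F ∪ G.addEnds V Y Sᶜ F with hW'
    have hprod : ∀ A : Finset ε, 0 ≤ ∏ e ∈ A, t e := fun A => Finset.prod_nonneg fun e _ => ht e
    have hW₁ : ∀ v ∈ W', v ∈ V → v ∈ S → v ∈ G.addEnds V Y S F := by
      intro v hv hvV hvS
      rcases Finset.mem_union.1 hv with hv | hv
      · rcases Finset.mem_union.1 hv with hv | hv
        · exact mem_addEnds.2 ⟨hvS, Or.inl (hWV v hv hvV)⟩
        · exact hv
      · exact absurd hvS (mem_addEnds.1 hv).1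
    have hW₂ : ∀ v ∈ W', v ∈ V → v ∈ Sᶜ → v ∈ G.addEnds V Y Sᶜ F := by
      intro v hv hvV hvS
      rcases Finset.mem_union.1 hv with hv | hv
      · rcases Finset.mem_union.1 hv with hv | hv
        · exact mem_addEnds.2 ⟨hvS, Or.inl (hWV v hv hvV)⟩
        · exact absurd (mem_addEnds.1 hv).1 hvS
      · exact hv
    simp_rw [← Finset.mul_sum]
    rw [mul_assoc]
    refine mul_le_mul_of_nonneg_left ?_ (hprod F)
    -- Sum over `C` first, with the edges of `F` and `B` already merged into the relation. The class
    -- count in the resulting bound is the one needed to apply the induction hypothesis to `B`.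
    calc _ ≤ ∑ B ∈ (E.filter (G.EndsIn Sᶜ)).powerset with
          G.IsRooted (X.filter (· ∈ Sᶜ)) (G.addEnds V Y Sᶜ F) B, (∏ e ∈ B, t e) *
            α ^ (((G.addEnds V Y S F).card : ℤ) -
              ((s ⊔ G.linkSetoid F) ⊔ G.linkSetoid B).classCount W' - 1) := by
          refine Finset.sum_le_sum fun B hB => mul_le_mul_of_nonneg_left ?_ (hprod B)
          refine side S ⟨z₂, hz₂V, hz₂S⟩ ⟨z₁, hz₁S, hz₁⟩ F W' _
            (Finset.subset_union_right.trans Finset.subset_union_left) hW₁ ?_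
          intro z hzV hzS hz
          refine Setoid.eq_of_sup_rel (hisol S F z hzV hzS hz)
            (eq_of_linkSetoid_rel fun e he hez => ?_)
          exact (Finset.mem_filter.1 (Finset.mem_powerset.1 (Finset.mem_filter.1 hB).1 he)).2 z hez
            hzS
      _ = α ^ (((G.addEnds V Y S F).card : ℤ) - 1) * G.rootedSum t α (E.filter (G.EndsIn Sᶜ))
            (X.filter (· ∈ Sᶜ)) (G.addEnds V Y Sᶜ F) W' (s ⊔ G.linkSetoid F) := by
          rw [rootedSum, Finset.mul_sum]
          refine Finset.sum_congr rfl fun B _ => ?_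
          rw [mul_left_comm, ← zpow_add₀ hα0.ne']
          congr 2
          ring
      _ ≤ α ^ (((G.addEnds V Y S F).card : ℤ) - 1) * α ^ (((G.addEnds V Y Sᶜ F).card : ℤ) -
            (s ⊔ G.linkSetoid F).classCount W' - 1) := by
          refine mul_le_mul_of_nonneg_left ?_ (zpow_nonneg hα0.le _)
          refine le_of_eq_of_le ?_ (side Sᶜ ⟨z₁, hz₁V, not_not.2 hz₁S⟩ ⟨z₂, hz₂S, Or.inr hz₂⟩ F W'
            _ Finset.subset_union_right hW₂ (hisol Sᶜ F))
          congr
      _ ≤ α ^ F.card * α ^ (n - 1) := by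
          rw [← zpow_add₀ hα0.ne', ← zpow_natCast, ← zpow_add₀ hα0.ne']
          refine zpow_le_zpow_right₀ hα.le ?_
          have := card_addEnds_add_card_addEnds_le (G := G) (S := S) (F := F) hYV hYW hWV hs
          rw [← hW'] at this
          omega
  refine (Finset.sum_le_sum hF).trans ?_
  rw [← Finset.sum_mul]
  calc _ ≤ α * α ^ (n - 1) :=
        mul_le_mul_of_nonneg_right (sum_powerset_prod_mul_pow_le ht hα hS) (zpow_nonneg hα0.le _)
    _ = α ^ n := by
        rw [← zpow_one_add₀ hα0.ne']
        congr 1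
        ring

open Classical in
/-- The total weight of all rooted edge sets is at most `α ^ (|Y| - 1)`. -/
theorem sum_isRooted_le (hG : G.Loopless) (hα : 1 < α) (ht : ∀ e, 0 ≤ t e) {V : Finset ν}
    {E : Finset ε} {X Y : Finset ν} (hEV : ∀ e ∈ E, ∀ v, G.Inc e v → v ∈ V)
    (hEG : ∀ e ∈ E, e ∈ E(G))
    (hcut : ∀ x ∈ V, ∀ y ∈ V, x ≠ y → ∃ S : Set ν, x ∈ S ∧ y ∉ S ∧
      ∑ e ∈ E with e ∈ G.cutEdges S, t e ≤ Real.log α / α)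
    (hXV : X ⊆ V) (hYV : Y ⊆ V) (hY : Y.Nonempty) :
    ∑ A ∈ E.powerset with G.IsRooted X Y A, ∏ e ∈ A, t e ≤ α ^ (Y.card - 1) := by
  have hα0 : 0 < α := zero_lt_one.trans hα
  -- With `Y` identified every class count is `1`, so the factor `α⁻¹` is common to all terms and
  -- cancels.
  let s : Setoid ν := Setoid.identify Y
  have hs : ∀ r : Setoid ν, (s ⊔ r).classCount Y = 1 := fun r =>
    Setoid.classCount_eq_one hY fun x hx y hy =>
      (le_sup_left : s ≤ s ⊔ r) (Or.inr ⟨hx, hy⟩)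
  have h := rootedSum_le hG hα ht V E X Y Y s hEV hEG hcut hXV hYV hY subset_rfl
    (fun v hv _ => hv) (fun z _ hzY v hzv => hzv.resolve_right fun h => hzY h.1)
  have hs' : s.classCount Y = 1 := by simpa using hs ⊥
  simp only [rootedSum, hs, hs', ← Finset.sum_mul] at h
  have hcard : (Y.card : ℤ) - (1 : ℕ) - 1 = ((Y.card - 1 : ℕ) : ℤ) + -((1 : ℕ) : ℤ) := by
    have := hY.card_pos
    omega
  rw [hcard, zpow_add₀ hα0.ne', zpow_natCast] at h
  exact le_of_mul_le_mul_right h (zpow_pos hα0 _)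

end

end Graph

/-! ### Cut vertices and blocks -/

namespace Graph

variable {ν ε : Type*} {H K : Graph ν ε} {c d x y z : ν}

lemma mem_component_self (H : Graph ν ε) (x : ν) : x ∈ H.component x :=
  Relation.ReflTransGen.refl

lemma mem_component_trans (h : y ∈ H.component x) (h' : z ∈ H.component y) :
    z ∈ H.component x :=
  Relation.ReflTransGen.trans h h'

lemma mem_component_symm (h : y ∈ H.component x) : x ∈ H.component y := by
  induction h with
  | refl => exact mem_component_self _ _
  | tail _ h ih => exact Relation.ReflTransGen.head h.symm ih

lemma component_subset_of_adj (h : ∀ x y, K.Adj x y → H.Adj x y) (x : ν) :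
    K.component x ⊆ H.component x :=
  fun y hy => Relation.ReflTransGen.mono h x y hy

lemma component_eq (h : y ∈ H.component x) : H.component y = H.component x :=
  Set.ext fun _ => ⟨mem_component_trans h, mem_component_trans (mem_component_symm h)⟩

lemma component_mono (h : K ≤ H) (x : ν) : K.component x ⊆ H.component x :=
  component_subset_of_adj (fun _ _ hab => hab.mono h) x

lemma mem_vertexSet_of_mem_component (hx : x ∈ V(H)) (h : y ∈ H.component x) : y ∈ V(H) := by
  induction h with
  | refl => exact hx
  | tail _ h _ => exact h.right_mem

lemma adj_deleteVerts : (H.deleteVerts {c}).Adj x y ↔ H.Adj x y ∧ x ≠ c ∧ y ≠ c := by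
  simp only [Adj, deleteVerts_isLink, Set.mem_singleton_iff, exists_and_right]

lemma adj_induce {T : Set ν} : (H.induce T).Adj x y ↔ H.Adj x y ∧ x ∈ T ∧ y ∈ T := by
  simp only [Adj, induce_isLink, exists_and_right]

lemma ne_of_mem_component_deleteVerts (hx : x ≠ c) (h : y ∈ (H.deleteVerts {c}).component x) :
    y ≠ c := by
  induction h with
  | refl => exact hx
  | tail _ h _ => exact (adj_deleteVerts.1 h).2.2

lemma mem_component_deleteVerts_of_notMem (hc : c ∉ H.component x) (h : y ∈ H.component x) :
    y ∈ (H.deleteVerts {c}).component x := by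
  induction h with
  | refl => exact mem_component_self _ _
  | tail h h' ih =>
    refine Relation.ReflTransGen.tail ih (adj_deleteVerts.2 ⟨h', ?_, ?_⟩)
    · rintro rfl; exact hc h
    · rintro rfl; exact hc (h.tail h')

lemma mem_component_deleteVerts_or_adj (hx : x ≠ c) (h : y ∈ H.component x) :
    (y ∈ (H.deleteVerts {c}).component x ∧ y ≠ c) ∨
      ∃ u ∈ (H.deleteVerts {c}).component x, H.Adj u c := by
  induction h with
  | refl => exact Or.inl ⟨mem_component_self _ _, hx⟩
  | @tail u v _ h ih =>
    rcases ih with ⟨hu, huc⟩ | ih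
    · by_cases hv : v = c
      · exact Or.inr ⟨u, hu, hv ▸ h⟩
      · exact Or.inl ⟨Relation.ReflTransGen.tail hu (adj_deleteVerts.2 ⟨h, huc, hv⟩), hv⟩
    · exact Or.inr ih

lemma finite_components (hH : V(H).Finite) : H.components.Finite := hH.image _

lemma IsConnected.ncard_components (h : H.IsConnected) : H.components.ncard = 1 := by
  obtain ⟨⟨x, hx⟩, h⟩ := h
  refine Set.ncard_eq_one.2 ⟨H.component x, Set.eq_singleton_iff_unique_mem.2 ⟨⟨x, hx, rfl⟩, ?_⟩⟩
  rintro _ ⟨y, hy, rfl⟩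
  exact component_eq (h x hx y hy)

lemma IsConnected.mem_component_deleteVerts (h : H.IsConnected) (hH : V(H).Finite)
    (hcut : ¬ H.IsCutVertex c) (hc : c ∈ V(H)) (hx : x ∈ V(H)) (hxc : x ≠ c) (hy : y ∈ V(H))
    (hyc : y ≠ c) : y ∈ (H.deleteVerts {c}).component x := by
  have h₁ : (H.deleteVerts {c}).components.ncard ≤ 1 := by
    rw [← h.ncard_components]
    exact not_lt.1 fun h => hcut ⟨hc, h⟩
  have hfin : (H.deleteVerts {c}).components.Finite :=
    finite_components (hH.subset (by simp))
  have := (Set.ncard_le_one hfin).1 h₁ _ ⟨x, by simp [hx, hxc], rfl⟩ _ ⟨y, by simp [hy, hyc], rfl⟩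
  rw [this]
  exact mem_component_self _ _

lemma IsConnected.not_isCutVertex (h : H.IsConnected) (hH : V(H).Finite)
    (hc : ∀ x ∈ V(H), x ≠ c → ∀ y ∈ V(H), y ≠ c → y ∈ (H.deleteVerts {c}).component x) :
    ¬ H.IsCutVertex c := by
  rintro ⟨-, hlt⟩
  rw [h.ncard_components] at hlt
  refine hlt.not_ge ((Set.ncard_le_one (finite_components (hH.subset (by simp)))).2 ?_)
  rintro _ ⟨x, hx, rfl⟩ _ ⟨y, hy, rfl⟩
  simp only [vertexSet_deleteVerts, Set.mem_sdiff, Set.mem_singleton_iff] at hx hy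
  exact (component_eq (hc x hx.1 hx.2 y hy.1 hy.2)).symm

lemma not_isCutVertex_of_forall_mem_component (hH : V(H).Finite) (hdc : d ∈ H.component c)
    (hd : ∀ x ∈ V(H), x ≠ d → x ∈ H.component c → c ∈ (H.deleteVerts {d}).component x) :
    ¬ H.IsCutVertex d := by
  classical
  rintro ⟨-, hlt⟩
  refine hlt.not_ge ?_
  -- Only the component of `c` changes when `d` is deleted, and it does not split; so `f` reaches
  -- all components of `H - d`.
  let f : Set ν → Set ν := fun C => if c ∈ C then (H.deleteVerts {d}).component c else C
  refine (Set.ncard_le_ncard (t := f '' H.components) ?_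
    ((finite_components hH).image f)).trans (Set.ncard_image_le (finite_components hH))
  rintro _ ⟨x, hx, rfl⟩
  simp only [vertexSet_deleteVerts, Set.mem_sdiff, Set.mem_singleton_iff] at hx
  refine ⟨H.component x, ⟨x, hx.1, rfl⟩, ?_⟩
  by_cases hcx : c ∈ H.component x
  · simp only [f, if_pos hcx]
    exact component_eq (hd x hx.1 hx.2 (mem_component_symm hcx))
  · simp only [f, if_neg hcx]
    refine Set.Subset.antisymm (fun y hy => mem_component_deleteVerts_of_notMem ?_ hy)
      (component_mono deleteVerts_le x)
    exact fun h => hcx (mem_component_trans h (mem_component_symm hdc))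

/-- The subgraph spanned by `c` and a component of `H - c` is a block, provided that no other vertex
of it separates a vertex from `c`. -/
lemma isBlock_induce_insert (hH : V(H).Finite) (hc : c ∈ V(H)) (hz : z ∈ V(H)) (hzc : z ≠ c)
    (hadj : ∃ u ∈ (H.deleteVerts {c}).component z, H.Adj u c)
    (hD : ∀ d ∈ (H.deleteVerts {c}).component z, ∀ x ∈ V(H), x ≠ d → x ∈ H.component c →
      c ∈ (H.deleteVerts {d}).component x) :
    (H.induce (insert c ((H.deleteVerts {c}).component z))).IsBlock H := by
  set D := (H.deleteVerts {c}).component z with hDdef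
  set B := H.induce (insert c D) with hB
  have hDV : D ⊆ V(H) := fun y hy => mem_vertexSet_of_mem_component hz
    (component_mono deleteVerts_le z hy)
  have hBV : insert c D ⊆ V(H) := Set.insert_subset hc hDV
  have hDc : ∀ y ∈ D, y ≠ c := fun y hy => ne_of_mem_component_deleteVerts hzc hy
  have hDB : ∀ x ∈ D, ∀ y ∈ D, y ∈ (B.deleteVerts {c}).component x := by
    intro x hx y hy
    have hxy : y ∈ (H.deleteVerts {c}).component x := mem_component_trans (mem_component_symm hx) hy
    clear hy
    induction hxy with
    | refl => exact mem_component_self _ _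
    | @tail u v hu h ih =>
      have hu : u ∈ D := mem_component_trans hx hu
      have hv : v ∈ D := Relation.ReflTransGen.tail hu h
      exact Relation.ReflTransGen.tail ih (adj_deleteVerts.2 ⟨adj_induce.2
        ⟨(adj_deleteVerts.1 h).1, Or.inr hu, Or.inr hv⟩, hDc u hu, hDc v hv⟩)
  obtain ⟨u, hu, huc⟩ := hadj
  have hDcomp : ∀ x ∈ D, c ∈ B.component x := fun x hx =>
    Relation.ReflTransGen.tail (component_mono deleteVerts_le x (hDB x hx u hu))
      (adj_induce.2 ⟨huc, Or.inr hu, Or.inl rfl⟩)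
  have hBH : B ≤ H := induce_le hBV
  have hcomp : ∀ x ∈ V(B), c ∈ B.component x := by
    rintro x (rfl | hx)
    · exact mem_component_self _ _
    · exact hDcomp x hx
  have hconn : B.IsConnected :=
    ⟨⟨c, Or.inl rfl⟩, fun x hx y hy => mem_component_trans (hcomp x hx)
      (mem_component_symm (hcomp y hy))⟩
  have hBfin : V(B).Finite := hH.subset hBV
  refine ⟨⟨hBH, hconn, fun v hv => ?_⟩, ?_⟩
  · refine hconn.not_isCutVertex hBfin ?_ hv
    rcases hv.1 with rfl | hvD
    · intro x hx hxv y hy hyv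
      exact hDB x (hx.resolve_left hxv) y (hy.resolve_left hyv)
    -- A walk to `c` in `H - v`, stopped at its first visit to `c`, cannot leave `D` before, so it
    -- runs inside `B - v`.
    · have key : ∀ x ∈ V(B), x ≠ v → c ∈ (B.deleteVerts {v}).component x := by
        intro x hx hxv
        have h := hD v hvD x (hBV hx) hxv (mem_component_symm (component_mono hBH x (hcomp x hx)))
        clear hxv
        induction h using Relation.ReflTransGen.head_induction_on with
        | refl => exact mem_component_self _ _
        | @head x x' h h' ih =>
          rcases hx with rfl | hx
          · exact mem_component_self _ _
          · obtain ⟨h, hxv, hxv'⟩ := adj_deleteVerts.1 h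
            have hx' : x' ∈ insert c D := by
              by_cases hxc' : x' = c
              · exact Or.inl hxc'
              · exact Or.inr (Relation.ReflTransGen.tail hx
                  (adj_deleteVerts.2 ⟨h, hDc x hx, hxc'⟩))
            exact Relation.ReflTransGen.head
              (adj_deleteVerts.2 ⟨adj_induce.2 ⟨h, Or.inr hx, hx'⟩, hxv, hxv'⟩) (ih hx')
      intro x hx hxv y hy hyv
      exact mem_component_trans (key x hx hxv) (mem_component_symm (key y hy hyv))
  · rintro K ⟨hKH, hK, hKcut⟩ hBK
    -- As `c` is no cut vertex of `K`, the graph `K - c` is connected, so it stays in the component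
    -- of `z` in `H - c`.
    have hKV : V(K) ⊆ insert c D := by
      intro k hk
      by_cases hkc : k = c
      · exact Or.inl hkc
      · have hVBK := hBK.1
        have := hK.mem_component_deleteVerts (hH.subset hKH.1) (hKcut c) (hVBK (Or.inl rfl))
          (hVBK (Or.inr (mem_component_self _ z))) hzc hk hkc
        refine Or.inr (component_subset_of_adj (fun a b hab => ?_) z this)
        obtain ⟨hab, h⟩ := adj_deleteVerts.1 hab
        exact adj_deleteVerts.2 ⟨hab.mono hKH, h⟩
    exact ⟨hKV, fun e a b h => ⟨h.mono hKH, hKV h.left_mem, hKV h.right_mem⟩⟩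

/-- If some component of some `H - c` avoids `Z`, then `H` has a block with at least two vertices
in which all vertices but one are internal vertices of `H` and outside `Z`. -/
lemma exists_isBlock_of_component_disjoint (hH : V(H).Finite) {Z : Set ν}
    (hZ : ∀ x ∈ V(H), ∃ v ∈ Z, v ∈ H.component x) (hz : z ∈ V(H)) (hzc : z ≠ c)
    (hdisj : ∀ v ∈ Z, v ∉ (H.deleteVerts {c}).component z) :
    ∃ b B, B.IsBlock H ∧ b ∈ V(B) ∧ V(B).Nontrivial ∧
      (∀ v ∈ V(B), v ≠ b → ¬ H.IsCutVertex v ∧ v ∉ Z) ∧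
      (H.IsConnected → ¬ H.IsCutVertex b → B = H) := by
  induction hn : ((H.deleteVerts {c}).component z).ncard using Nat.strong_induction_on
    generalizing c z with
  | _ n ih =>
  set D := (H.deleteVerts {c}).component z with hD
  have hDV : D ⊆ V(H) := fun y hy => mem_vertexSet_of_mem_component hz
    (component_mono deleteVerts_le z hy)
  have hDc : ∀ y ∈ D, y ≠ c := fun y hy => ne_of_mem_component_deleteVerts hzc hy
  have hadj : ∃ u ∈ D, H.Adj u c := by
    obtain ⟨v, hvZ, hv⟩ := hZ z hz
    exact (mem_component_deleteVerts_or_adj hzc hv).resolve_left fun h => hdisj v hvZ h.1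
  obtain ⟨u, hu, huc⟩ := hadj
  have hc : c ∈ V(H) := huc.right_mem
  have hDcomp : ∀ y ∈ D, y ∈ H.component c := fun y hy =>
    mem_component_trans (mem_component_symm (Relation.ReflTransGen.tail
      (mem_component_self H u) huc)) (component_mono deleteVerts_le u
        (mem_component_trans (mem_component_symm hu) hy))
  by_cases hsep : ∀ d ∈ D, ∀ x ∈ V(H), x ≠ d → x ∈ H.component c →
      c ∈ (H.deleteVerts {d}).component x
  · refine ⟨c, H.induce (insert c D), isBlock_induce_insert hH hc hz hzc ⟨u, hu, huc⟩ hsep,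
      Or.inl rfl, ⟨z, Or.inr (mem_component_self _ z), c, Or.inl rfl, hzc⟩, ?_, ?_⟩
    · intro v hv hvc
      have hv : v ∈ D := hv.resolve_left hvc
      exact ⟨not_isCutVertex_of_forall_mem_component hH (hDcomp v hv) (hsep v hv),
        fun hvZ => hdisj v hvZ hv⟩
    · intro hconn hcut
      have : insert c D = V(H) := by
        refine Set.Subset.antisymm (Set.insert_subset hc hDV) fun y hy => ?_
        by_cases hyc : y = c
        · exact Or.inl hyc
        · exact Or.inr (hconn.mem_component_deleteVerts hH hcut hc hz hzc hy hyc)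
      rw [this, induce_vertexSet]
  -- Some `d ∈ D` separates `x` from `c`. The component of `x` in `H - d` lies in `D` and misses
  -- `d`, so it is a smaller component that avoids `Z`.
  · push Not at hsep
    obtain ⟨d, hd, x, hx, hxd, hxc, hcx⟩ := hsep
    set D' := (H.deleteVerts {d}).component x with hD'
    obtain ⟨u', hu', hud'⟩ := (mem_component_deleteVerts_or_adj hxd
      (mem_component_symm hxc)).resolve_left fun h => hcx h.1
    have hsub : D' ⊆ D := by
      intro y hy
      have huy : y ∈ (H.deleteVerts {d}).component u' :=
        mem_component_trans (mem_component_symm hu') hy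
      have hcu : c ∉ (H.deleteVerts {d}).component u' := fun h => hcx (mem_component_trans hu' h)
      have hu'D : u' ∈ D := Relation.ReflTransGen.tail hd (adj_deleteVerts.2
        ⟨hud'.symm, hDc d hd, fun h => hcu (h ▸ mem_component_self _ _)⟩)
      refine mem_component_trans hu'D (component_subset_of_adj (fun a b hab => ?_) u'
        (mem_component_deleteVerts_of_notMem hcu huy))
      obtain ⟨hab, h⟩ := adj_deleteVerts.1 hab
      exact adj_deleteVerts.2 ⟨(adj_deleteVerts.1 hab).1, h⟩
    have hss : D' ⊂ D :=
      ⟨hsub, fun h => ne_of_mem_component_deleteVerts hxd (h hd) rfl⟩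
    exact ih D'.ncard (hn ▸ Set.ncard_lt_ncard hss (hH.subset hDV)) hx hxd
      (fun v hv h => hdisj v hv (hsub h)) rfl

lemma IsBlock.isIsolatedBlock_or_isEndBlock {B : Graph ν ε} {b : ν} (hB : B.IsBlock H)
    (hb : b ∈ V(B)) (h : ∀ v ∈ V(B), v ≠ b → ¬ H.IsCutVertex v) :
    (¬ H.IsCutVertex b ∧ B.IsIsolatedBlock H) ∨ (H.IsCutVertex b ∧ B.IsEndBlock H) := by
  by_cases hc : H.IsCutVertex b
  · exact Or.inr ⟨hc, hB, b, ⟨hb, hc⟩, fun v hv => by_contra fun hvb => h v hv.1 hvb hv.2⟩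
  · refine Or.inl ⟨hc, hB, fun v hv => ?_⟩
    by_cases hvb : v = b
    · rwa [hvb]
    · exact h v hv hvb

/-- If every component, every end block and every isolated block of `H` meets `Z` in the required
way, then every component of every `H - c` meets `Z`. -/
lemma exists_mem_component_deleteVerts (hH : V(H).Finite) {Z : Set ν}
    (hZ : ∀ x ∈ V(H), ∃ v ∈ Z, v ∈ H.component x)
    (hend : ∀ B : Graph ν ε, B.IsEndBlock H → (B.internalVerts H ∩ Z).Nonempty)
    (hiso : ∀ B : Graph ν ε, B.IsIsolatedBlock H → V(B).Nontrivial →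
      (H.IsConnected → B = H) → (V(B) ∩ Z).Nontrivial)
    (hz : z ∈ V(H)) (hzc : z ≠ c) : ∃ v ∈ Z, v ∈ (H.deleteVerts {c}).component z := by
  by_contra hdisj
  push Not at hdisj
  obtain ⟨b, B, hB, hb, hBn, hBb, hBH⟩ := exists_isBlock_of_component_disjoint hH hZ hz hzc hdisj
  rcases hB.isIsolatedBlock_or_isEndBlock hb fun v hv hvb => (hBb v hv hvb).1 with
    ⟨hcut, h⟩ | ⟨hcut, h⟩
  · obtain ⟨v, hv, hvb⟩ := (hiso B h hBn fun hconn => hBH hconn hcut).exists_ne b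
    exact (hBb v hv.1 hvb).2 hv.2
  · obtain ⟨v, ⟨hv, hvcut⟩, hvZ⟩ := hend B h
    exact (hBb v hv fun h => hvcut (h ▸ hcut)).2 hvZ

end Graph

/-! ### Block forests and block trees as rooted edge sets -/

namespace Graph

variable {ν ε : Type*} {G H K : Graph ν ε} {X Y : Set ν} {w : ε → ℝ}

/-- A common weakening of the conditions that define block trees and (enlarged) block forests. -/
structure IsRootedSubgraph (G : Graph ν ε) (X Y : Set ν) (H : Graph ν ε) : Prop where
  le : H ≤ G
  subset : X ∪ Y ⊆ V(H)
  exists_mem_component : ∀ x ∈ V(H), ∃ y ∈ Y, y ∈ H.component x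
  internalVerts_inter_nonempty : ∀ B : Graph ν ε, B.IsEndBlock H →
    (B.internalVerts H ∩ (X ∪ Y)).Nonempty
  inter_nontrivial : ∀ B : Graph ν ε, B.IsIsolatedBlock H → V(B).Nontrivial →
    (H.IsConnected → B = H) → (V(B) ∩ (X ∪ Y)).Nontrivial

lemma isRootedSubgraph_of_mem_enlargedBlockForests {m : ℕ}
    (h : H ∈ G.enlargedBlockForests m X Y) : G.IsRootedSubgraph X Y H := by
  obtain ⟨hle, -, hXY, hcomp, hend, hiso⟩ := h
  refine ⟨hle, hXY, fun x hx => ?_, hend, fun B hB hBn _ => ?_⟩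
  · obtain ⟨y, hy, hyY⟩ := hcomp _ ⟨x, hx, rfl⟩
    exact ⟨y, hyY, hy⟩
  · refine (hiso B hB).resolve_left ?_
    rintro ⟨y, -, rfl⟩
    exact Set.not_nontrivial_singleton hBn

lemma blockForests_subset_enlargedBlockForests (m : ℕ) :
    G.blockForests m X Y ⊆ G.enlargedBlockForests m X Y :=
  fun _ ⟨h₁, h₂, h₃, h₄, h₅⟩ => ⟨h₁, h₂, h₃, fun C hC => (h₄ C hC).exists, h₅⟩

/-- By connectedness any one vertex of `X` can serve as the only root. Block trees restrict isolated
blocks only when `H` is itself a block; the premise `H.IsConnected → B = H` of `inter_nontrivial`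
reduces to that case. -/
lemma isRootedSubgraph_of_mem_blockTrees {m : ℕ} {x : ν} (hx : x ∈ X)
    (h : H ∈ G.blockTrees m X) : G.IsRootedSubgraph X {x} H := by
  obtain ⟨hle, -, hX, hconn, hend, hblock⟩ := h
  have hXx : X ∪ {x} = X := Set.union_eq_self_of_subset_right (Set.singleton_subset_iff.2 hx)
  refine ⟨hle, hXx.le.trans hX, fun z hz => ⟨x, rfl, hconn.2 z hz x (hX hx)⟩, hXx.symm ▸ hend, ?_⟩
  intro B hB hBn hBH
  obtain rfl := hBH hconn
  rw [hXx]
  refine (hblock hB.1).resolve_left ?_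
  rintro ⟨y, rfl⟩
  exact Set.not_nontrivial_singleton hBn

lemma IsRootedSubgraph.mem_vertexSet_iff (h : G.IsRootedSubgraph X Y H) {v : ν} :
    v ∈ V(H) ↔ v ∈ Y ∨ ∃ e ∈ E(H), G.Inc e v := by
  constructor
  · intro hv
    obtain ⟨y, hy, hvy⟩ := h.exists_mem_component v hv
    rcases Relation.ReflTransGen.cases_head hvy with rfl | ⟨u, ⟨e, he⟩, -⟩
    · exact Or.inl hy
    · exact Or.inr ⟨e, he.edge_mem, (he.mono h.le).inc_left⟩
  · rintro (hv | ⟨e, he, hev⟩)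
    · exact h.subset (Or.inr hv)
    · exact ((IsSubgraph.inc_congr h.le he).2 hev).vertex_mem

/-- A vertex outside `Y` has an edge, the first on its walk to `Y`; so `Y` and the edges determine
the vertices. This lets edge sets stand for subgraphs. -/
lemma IsRootedSubgraph.eq_of_edgeSet_eq (hH : G.IsRootedSubgraph X Y H)
    (hK : G.IsRootedSubgraph X Y K) (h : E(H) = E(K)) : H = K := by
  refine Compatible.ext (Set.ext fun v => ?_) h (Compatible.of_le_le hH.le hK.le)
  rw [hH.mem_vertexSet_iff, hK.mem_vertexSet_iff, h]

lemma IsRootedSubgraph.reach (h : H ≤ G) {A : Finset ε} (hA : ∀ e, e ∈ A ↔ e ∈ E(H)) {D : Set ν}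
    {x y : ν} (hKD : K ≤ H) (hD : ∀ v ∈ V(K), v ∉ D) (hxy : y ∈ K.component x) :
    G.Reach A D x y := by
  refine Relation.ReflTransGen.mono (fun a b hab => ?_) x y hxy
  obtain ⟨e, he⟩ := hab
  exact ⟨e, (hA e).2 (he.mono hKD).edge_mem, (he.mono hKD).mono h, hD a he.left_mem,
    hD b he.right_mem⟩

lemma IsRootedSubgraph.isRooted {X Y : Finset ν} (h : G.IsRootedSubgraph X Y H)
    (hV : V(G).Finite) {A : Finset ε} (hA : ∀ e, e ∈ A ↔ e ∈ E(H)) : G.IsRooted X Y A where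
  exists_reach z hz := by
    have hzV : z ∈ V(H) := by
      rcases hz with hz | ⟨e, he, hez⟩
      · exact h.subset (Or.inl hz)
      · exact h.mem_vertexSet_iff.2 (Or.inr ⟨e, (hA e).1 he, hez⟩)
    obtain ⟨y, hy, hzy⟩ := h.exists_mem_component z hzV
    exact ⟨y, hy, reach h.le hA le_rfl (fun v _ => Set.notMem_empty v) hzy⟩
  exists_reach_avoiding c z hzc hz := by
    obtain ⟨e, he, hez⟩ := hz
    have hzV : z ∈ V(H) := h.mem_vertexSet_iff.2 (Or.inr ⟨e, (hA e).1 he, hez⟩)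
    have hHV : V(H).Finite := hV.subset h.le.1
    obtain ⟨v, hv, hzv⟩ := exists_mem_component_deleteVerts hHV (Z := X ∪ Y)
      (fun x hx => (h.exists_mem_component x hx).imp fun y hy => ⟨Or.inr hy.1, hy.2⟩)
      h.internalVerts_inter_nonempty h.inter_nontrivial hzV hzc
    refine ⟨v, hv, ne_of_mem_component_deleteVerts hzc hzv,
      reach h.le hA deleteVerts_le (fun u hu => ?_) hzv⟩
    rw [vertexSet_deleteVerts] at hu
    exact hu.2

/-! ### Cuts and the maxmaxflow -/

section Cuts

lemma cutEdges_subset (G : Graph ν ε) (S : Set ν) : G.cutEdges S ⊆ E(G) :=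
  fun _ ⟨_, _, h, _⟩ => h.edge_mem

lemma exists_cut_le_maxmaxflow (hV : V(G).Finite) (w : ε → ℝ) {x y : ν}
    (hx : x ∈ V(G)) (hy : y ∈ V(G)) (hxy : x ≠ y) :
    ∃ S : Set ν, x ∈ S ∧ y ∉ S ∧ ∑ᶠ e ∈ G.cutEdges S, w e ≤ G.maxmaxflow w := by
  have hmem : G.minCut w x y ∈ {c | ∃ S ⊆ V(G), x ∈ S ∧ y ∉ S ∧
      c = ∑ᶠ e ∈ G.cutEdges S, w e} := by
    refine Set.Nonempty.csInf_mem ⟨_, {x}, by simpa, rfl, fun h => hxy h.symm, rfl⟩ ?_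
    refine (hV.finite_subsets.image fun S => ∑ᶠ e ∈ G.cutEdges S, w e).subset ?_
    rintro c ⟨S, hS, -, -, rfl⟩
    exact ⟨S, hS, rfl⟩
  obtain ⟨S, -, hxS, hyS, hS⟩ := hmem
  refine ⟨S, hxS, hyS, hS ▸ le_csSup (Set.Finite.bddAbove ?_) ⟨x, hx, y, hy, hxy, rfl⟩⟩
  refine ((hV.prod hV).image fun p => G.minCut w p.1 p.2).subset ?_
  rintro c ⟨x, hx, y, hy, -, rfl⟩
  exact ⟨(x, y), ⟨hx, hy⟩, rfl⟩

lemma maxmaxflow_nonneg (hw : ∀ e ∈ E(G), 0 ≤ w e) : 0 ≤ G.maxmaxflow w := by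
  refine Real.sSup_nonneg ?_
  rintro _ ⟨x, -, y, -, -, rfl⟩
  refine Real.sInf_nonneg ?_
  rintro _ ⟨S, -, -, -, rfl⟩
  exact finsum_nonneg fun e => finsum_nonneg fun he => hw e (G.cutEdges_subset S he)

/-- The two ends of `e` are distinct, so some cut of weight at most `0` separates them, and it
contains `e`. -/
lemma eq_zero_of_maxmaxflow_eq_zero (hV : V(G).Finite) (hE : E(G).Finite) (hG : G.Loopless)
    (hw : ∀ e ∈ E(G), 0 ≤ w e) (h : G.maxmaxflow w = 0) {e : ε} (he : e ∈ E(G)) : w e = 0 := by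
  obtain ⟨x, y, hxy⟩ := exists_isLink_of_mem_edgeSet he
  obtain ⟨S, hxS, hyS, hS⟩ := exists_cut_le_maxmaxflow hV w hxy.left_mem hxy.right_mem hxy.ne
  refine le_antisymm ?_ (hw e he)
  rw [h, finsum_mem_eq_finite_toFinset_sum _ (hE.subset (G.cutEdges_subset S))] at hS
  refine (Finset.single_le_sum (f := w) (fun f hf => hw f ?_) ?_).trans hS
  · exact G.cutEdges_subset S ((Set.Finite.mem_toFinset _).1 hf)
  · exact (Set.Finite.mem_toFinset _).2 ⟨x, y, hxy, hxS, hyS⟩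

end Cuts

/-! ### Weighted counts of families of subgraphs -/

section Families

variable {𝓗 : ℕ → Set (Graph ν ε)}

open Classical in
lemma mem_filter_edgeSet (hE : E(G).Finite) (hH : H ≤ G) (e : ε) :
    e ∈ hE.toFinset.filter (· ∈ E(H)) ↔ e ∈ E(H) := by
  rw [Finset.mem_filter, Set.Finite.mem_toFinset]
  exact ⟨fun h => h.2, fun h => ⟨IsSubgraph.edgeSet_mono hH h, h⟩⟩

open Classical in
lemma weight_eq_prod (hE : E(G).Finite) (hH : H ≤ G) (w : ε → ℝ) :
    H.weight w = ∏ e ∈ hE.toFinset.filter (· ∈ E(H)), w e := by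
  have : E(H) = (hE.toFinset.filter (· ∈ E(H)) : Finset ε) :=
    Set.ext fun e => (mem_filter_edgeSet hE hH e).symm
  rw [weight]
  conv_lhs => rw [this]
  exact finprod_mem_coe_finset _ _

open Classical in
lemma finite_of_isRootedSubgraph (hE : E(G).Finite) {𝓚 : Set (Graph ν ε)}
    (h𝓚 : ∀ H ∈ 𝓚, G.IsRootedSubgraph X Y H) : 𝓚.Finite := by
  refine Set.Finite.of_finite_image (f := fun H => E(H))
    (hE.finite_subsets.subset ?_) fun H hH K hK h => (h𝓚 H hH).eq_of_edgeSet_eq (h𝓚 K hK) h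
  rintro _ ⟨H, hH, rfl⟩
  exact IsSubgraph.edgeSet_mono (h𝓚 H hH).le

open Classical in
lemma pow_mul_finsum_weight_le {X Y : Finset ν} (hV : V(G).Finite) (hE : E(G).Finite) {β : ℝ}
    {t : ε → ℝ} (ht : ∀ e, 0 ≤ t e) (htw : ∀ e ∈ E(G), t e = β * w e) {m : ℕ}
    {𝓚 : Set (Graph ν ε)} (h𝓚 : ∀ H ∈ 𝓚, G.IsRootedSubgraph X Y H ∧ E(H).ncard = m) :
    β ^ m * ∑ᶠ H ∈ 𝓚, H.weight w ≤
      ∑ A ∈ hE.toFinset.powerset.filter (G.IsRooted X Y) with A.card = m, ∏ e ∈ A, t e := by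
  have hfin := finite_of_isRootedSubgraph hE fun H hH => (h𝓚 H hH).1
  rw [finsum_mem_eq_finite_toFinset_sum _ hfin, Finset.mul_sum]
  let φ : Graph ν ε → Finset ε := fun H => hE.toFinset.filter (· ∈ E(H))
  have hφ : ∀ H ∈ 𝓚, ∀ e, e ∈ φ H ↔ e ∈ E(H) := fun H hH => mem_filter_edgeSet hE (h𝓚 H hH).1.le
  have hφ' : ∀ H ∈ 𝓚, (φ H : Set ε) = E(H) := fun H hH => Set.ext (hφ H hH)
  have hcard : ∀ H ∈ 𝓚, (φ H).card = m := fun H hH => by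
    rw [← Set.ncard_coe_finset, hφ' H hH, (h𝓚 H hH).2]
  calc ∑ H ∈ hfin.toFinset, β ^ m * H.weight w = ∑ H ∈ hfin.toFinset, ∏ e ∈ φ H, t e := by
        refine Finset.sum_congr rfl fun H hH => ?_
        have hH := hfin.mem_toFinset.1 hH
        rw [weight_eq_prod hE (h𝓚 H hH).1.le, ← hcard H hH, ← Finset.prod_const,
          ← Finset.prod_mul_distrib]
        exact Finset.prod_congr rfl fun e he =>
          (htw e (hE.mem_toFinset.1 (Finset.mem_filter.1 he).1)).symm
    _ = ∑ A ∈ hfin.toFinset.image φ, ∏ e ∈ A, t e := by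
        refine (Finset.sum_image (f := fun A : Finset ε => ∏ e ∈ A, t e) (g := φ)
          fun H hH K hK h => ?_).symm
        have hH := hfin.mem_toFinset.1 hH
        have hK := hfin.mem_toFinset.1 hK
        refine (h𝓚 H hH).1.eq_of_edgeSet_eq (h𝓚 K hK).1 ?_
        rw [← hφ' H hH, ← hφ' K hK, h]
    _ ≤ _ := by
        refine Finset.sum_le_sum_of_subset_of_nonneg (fun A hA => ?_)
          fun A _ _ => Finset.prod_nonneg fun e _ => ht e
        obtain ⟨H, hH, rfl⟩ := Finset.mem_image.1 hA
        have hH := hfin.mem_toFinset.1 hH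
        exact Finset.mem_filter.2 ⟨Finset.mem_filter.2
          ⟨Finset.mem_powerset.2 (Finset.filter_subset _ _), (h𝓚 H hH).1.isRooted hV (hφ H hH)⟩,
          hcard H hH⟩

/-- The weighted count of any family of rooted subgraphs, graded by the number of edges. -/
theorem summable_and_tsum_le (hV : V(G).Finite) (hE : E(G).Finite) (hG : G.Loopless)
    (hw : ∀ e ∈ E(G), 0 ≤ w e) (hX : X ⊆ V(G)) (hY : Y ⊆ V(G)) (hYne : Y.Nonempty) {a : ℝ}
    (ha : 1 < a) (h𝓗 : ∀ m, ∀ H ∈ 𝓗 m, G.IsRootedSubgraph X Y H ∧ E(H).ncard = m) :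
    Summable (fun m : ℕ =>
      (a * G.maxmaxflow w / Real.log a) ^ (-(m : ℤ)) * ∑ᶠ H ∈ 𝓗 m, H.weight w) ∧
    ∑' m : ℕ, (a * G.maxmaxflow w / Real.log a) ^ (-(m : ℤ)) * ∑ᶠ H ∈ 𝓗 m, H.weight w
      ≤ a ^ (Y.ncard - 1) := by
  classical
  lift X to Finset ν using hV.subset hX
  lift Y to Finset ν using hV.subset hY
  have ha0 : 0 < a := zero_lt_one.trans ha
  have hlog : 0 < Real.log a := Real.log_pos ha
  have hΛ := maxmaxflow_nonneg hw
  set Λ := G.maxmaxflow w with hΛdef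
  -- For `Λ = 0` this is `0⁻¹ = 0`, so the terms with `m ≥ 1` vanish while `0 ^ 0 = 1` keeps the
  -- term `m = 0`, as the reading convention requires.
  set β := (a * Λ / Real.log a)⁻¹ with hβ
  have hβ0 : 0 ≤ β := by positivity
  simp_rw [zpow_neg, zpow_natCast, ← inv_pow, ← hβ]
  have hzero : ∀ m ∉ Finset.range (hE.toFinset.card + 1),
      β ^ m * ∑ᶠ H ∈ 𝓗 m, H.weight w = 0 := by
    intro m hm
    have : 𝓗 m = ∅ := Set.eq_empty_of_forall_notMem fun H hH => hm ?_
    · simp [this]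
    · have := Set.ncard_le_ncard (IsSubgraph.edgeSet_mono (h𝓗 m H hH).1.le) hE
      rw [(h𝓗 m H hH).2, Set.ncard_eq_toFinset_card _ hE] at this
      exact Finset.mem_range.2 (Nat.lt_succ_of_le this)
  refine ⟨summable_of_ne_finset_zero hzero, ?_⟩
  rw [tsum_eq_sum hzero, Set.ncard_coe_finset]
  -- The weights are known to be nonnegative only on `E(G)`, whereas the bound for rooted sets needs
  -- `0 ≤ t e` everywhere.
  let t : ε → ℝ := fun e => if e ∈ E(G) then β * w e else 0
  have htw : ∀ e ∈ E(G), t e = β * w e := fun e he => if_pos he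
  have ht : ∀ e, 0 ≤ t e := by
    intro e
    by_cases he : e ∈ E(G)
    · rw [htw e he]
      exact mul_nonneg hβ0 (hw e he)
    · exact (if_neg he).ge
  have hcut : ∀ x ∈ hV.toFinset, ∀ y ∈ hV.toFinset, x ≠ y → ∃ S : Set ν, x ∈ S ∧ y ∉ S ∧
      ∑ e ∈ hE.toFinset with e ∈ G.cutEdges S, t e ≤ Real.log a / a := by
    intro x hx y hy hxy
    obtain ⟨S, hxS, hyS, hS⟩ := exists_cut_le_maxmaxflow hV w (hV.mem_toFinset.1 hx)
      (hV.mem_toFinset.1 hy) hxy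
    refine ⟨S, hxS, hyS, ?_⟩
    have hcutS : G.cutEdges S = (hE.toFinset.filter (· ∈ G.cutEdges S) : Finset ε) := by
      ext e
      simpa using fun he => G.cutEdges_subset S he
    rw [hcutS, finsum_mem_coe_finset] at hS
    calc ∑ e ∈ hE.toFinset with e ∈ G.cutEdges S, t e
        = β * ∑ e ∈ hE.toFinset with e ∈ G.cutEdges S, w e := by
          rw [Finset.mul_sum]
          exact Finset.sum_congr rfl fun e he =>
            htw e (hE.mem_toFinset.1 (Finset.mem_filter.1 he).1)
      _ ≤ β * Λ := mul_le_mul_of_nonneg_left hS hβ0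
      _ ≤ Real.log a / a := by
          -- For `Λ > 0` there is equality, by the choice of `β`.
          rcases hΛ.eq_or_lt with h | h
          · rw [← h, mul_zero]
            positivity
          · rw [hβ, inv_div]
            exact le_of_eq (by field_simp)
  refine le_trans (Finset.sum_le_sum fun m _ =>
    pow_mul_finsum_weight_le (𝓚 := 𝓗 m) hV hE ht htw (h𝓗 m)) ?_
  rw [Finset.sum_fiberwise_of_maps_to]
  · exact sum_isRooted_le hG ha ht (V := hV.toFinset)
      (fun e _ v hv => hV.mem_toFinset.2 hv.vertex_mem) (fun e he => hE.mem_toFinset.1 he) hcut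
      (fun x hx => hV.mem_toFinset.2 (hX hx)) (fun y hy => hV.mem_toFinset.2 (hY hy)) hYne
  · intro A hA
    have := Finset.card_le_card (Finset.mem_powerset.1 (Finset.mem_filter.1 hA).1)
    exact Finset.mem_range.2 (Nat.lt_succ_of_le this)

lemma finsum_weight_eq_zero (hV : V(G).Finite) (hE : E(G).Finite) (hG : G.Loopless)
    (hw : ∀ e ∈ E(G), 0 ≤ w e) (hΛ : G.maxmaxflow w = 0) {m : ℕ} (hm : 1 ≤ m)
    {𝓚 : Set (Graph ν ε)} (h𝓚 : ∀ H ∈ 𝓚, H ≤ G ∧ E(H).ncard = m) :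
    ∑ᶠ H ∈ 𝓚, H.weight w = 0 := by
  classical
  refine finsum_mem_of_eqOn_zero fun H hH => ?_
  obtain ⟨hle, hcard⟩ := h𝓚 H hH
  obtain ⟨e, he⟩ : E(H).Nonempty := Set.nonempty_of_ncard_ne_zero (by omega)
  rw [weight_eq_prod hE hle]
  exact Finset.prod_eq_zero ((mem_filter_edgeSet hE hle e).2 he)
    (eq_zero_of_maxmaxflow_eq_zero hV hE hG hw hΛ (IsSubgraph.edgeSet_mono hle he))

end Families

end Graph

theorem proposition7p7 {ν ε : Type*} (G : Graph ν ε) (hV : V(G).Finite) (hE : E(G).Finite)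
    (hG : G.Loopless) (w : ε → ℝ) (hw : ∀ e ∈ E(G), 0 ≤ w e) :
    -- the bound for enlarged block forests
    (∀ X Y : Set ν, X ⊆ V(G) → Y ⊆ V(G) → Y.Nonempty → ∀ a : ℝ, 1 < a → a ≤ 2 →
      Summable (fun m : ℕ => (a * G.maxmaxflow w / Real.log a) ^ (-(m : ℤ)) * G.bfStar w m X Y) ∧
      ∑' m : ℕ, (a * G.maxmaxflow w / Real.log a) ^ (-(m : ℤ)) * G.bfStar w m X Y
        ≤ a ^ (Y.ncard - 1)) ∧
    -- the bound for block forests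
    (∀ X Y : Set ν, X ⊆ V(G) → Y ⊆ V(G) → Y.Nonempty → ∀ a : ℝ, 1 < a → a ≤ 2 →
      Summable (fun m : ℕ => (a * G.maxmaxflow w / Real.log a) ^ (-(m : ℤ)) * G.bf w m X Y) ∧
      ∑' m : ℕ, (a * G.maxmaxflow w / Real.log a) ^ (-(m : ℤ)) * G.bf w m X Y
        ≤ a ^ (Y.ncard - 1)) ∧
    -- the bound for block trees
    (∀ X : Set ν, X ⊆ V(G) → X.Nonempty →
      Summable (fun m : ℕ => (2 * G.maxmaxflow w / Real.log 2) ^ (-(m : ℤ)) * G.bt w m X) ∧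
      ∑' m : ℕ, (2 * G.maxmaxflow w / Real.log 2) ^ (-(m : ℤ)) * G.bt w m X ≤ 1) ∧
    -- if the maxmaxflow vanishes, then the terms with `m ≥ 1` vanish because the counts do
    (G.maxmaxflow w = 0 → ∀ m : ℕ, 1 ≤ m →
      (∀ X Y : Set ν, X ⊆ V(G) → Y ⊆ V(G) → Y.Nonempty →
        G.bfStar w m X Y = 0 ∧ G.bf w m X Y = 0) ∧
      (∀ X : Set ν, X ⊆ V(G) → X.Nonempty → G.bt w m X = 0)) := by

  have forest : ∀ X Y : Set ν, ∀ m, ∀ H ∈ G.blockForests m X Y,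
      G.IsRootedSubgraph X Y H ∧ E(H).ncard = m := fun X Y m H hH =>
    ⟨Graph.isRootedSubgraph_of_mem_enlargedBlockForests
      (Graph.blockForests_subset_enlargedBlockForests m hH), hH.2.1⟩
  refine ⟨fun X Y hX hY hYne a ha _ => ?_, fun X Y hX hY hYne a ha _ => ?_, fun X hX hXne => ?_,
    fun hΛ m hm => ⟨fun X Y _ _ _ => ⟨?_, ?_⟩, fun X _ _ => ?_⟩⟩
  · exact Graph.summable_and_tsum_le hV hE hG hw hX hY hYne ha fun m H hH =>
      ⟨Graph.isRootedSubgraph_of_mem_enlargedBlockForests hH, hH.2.1⟩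
  · exact Graph.summable_and_tsum_le hV hE hG hw hX hY hYne ha (forest X Y)
  · obtain ⟨x, hx⟩ := hXne
    have h := Graph.summable_and_tsum_le hV hE hG hw hX
      (Set.singleton_subset_iff.2 (hX hx)) (Set.singleton_nonempty x) one_lt_two
      (𝓗 := fun m => G.blockTrees m X) fun m H hH =>
        ⟨Graph.isRootedSubgraph_of_mem_blockTrees hx hH, hH.2.1⟩
    rwa [Set.ncard_singleton, Nat.sub_self, pow_zero] at h
  · exact Graph.finsum_weight_eq_zero hV hE hG hw hΛ hm fun H hH => ⟨hH.1, hH.2.1⟩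
  · exact Graph.finsum_weight_eq_zero hV hE hG hw hΛ hm fun H hH => ⟨hH.1, hH.2.1⟩
  · exact Graph.finsum_weight_eq_zero hV hE hG hw hΛ hm fun H hH => ⟨hH.1, hH.2.1⟩
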